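/- **Notation.** Let $S^1=\mathbb R/\mathbb Z$ and $s>5/2$. For $r>1/2$ let $H^r(S^1)$ be the real Sobolev space (its elements are continuous), $H^r_0(S^1)=\{u\in H^r(S^1): u(0)=0\}$, and let $H^r(S^1)/\mathbb R$ be the quotient by the constant functions, $[\alpha]$ denoting the class of $\alpha$. Let $\mathrm{Diff}^s_0(S^1)$ be the set of orientation-preserving diffeomorphisms $\varphi$ of $S^1$ of class $H^s$ with $\varphi(0)=0$, a manifold modelled on $H^s_0(S^1)$ through $\varphi=\mathrm{id}+v$, $v\in H_0^s(S^1)$. Put $$G^s=\mathrm{Diff}^s_0(S^1)\times H^{s-1}(S^1),\qquad K^s=\mathrm{Diff}^s_0(S^1)\times \bigl(H^{s-1}(S^1)/\mathbb R\bigr),$$ with the pseudo-Riemannian metrics $$\langle U,V\rangle_{(\varphi,\alpha)}=\tfrac14\int_{S^1}\Bigl(\tfrac{U_{1x}V_{1x}}{\varphi_x}-U_2V_2\,\varphi_x\Bigr)dx,\qquad U,V\in T_{(\varphi,\alpha)}G^s\simeq H^s_0(S^1)\times H^{s-1}(S^1),$$ $$\langle (U_1,[U_2]),(V_1,[V_2])\rangle_{(\varphi,[\alpha])}=\tfrac14\int_{S^1}\Bigl(\tfrac{U_{1x}V_{1x}}{\varphi_x}-\pi(U_2)\pi(V_2)\,\varphi_x\Bigr)dx,\qquad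 \pi(U_2)=U_2-\int_{S^1}U_2\,\varphi_x\,dx .$$ Let $\mathcal U^{s-1}$ be the set of all $f=(f_1,f_2)\in H^{s-1}(S^1;\mathbb R^2)$ with $\int_{S^1}(f_1^2-f_2^2)\,dx=1$ and, for all $x\in S^1$, $f_1(x)>0$ and $f_1(x)^2-f_2(x)^2>0$; it is a submanifold of $H^{s-1}(S^1;\mathbb R^2)$ with the metric induced by $\langle\!\langle X,Y\rangle\!\rangle=\int_{S^1}(X_1Y_1-X_2Y_2)\,dx$. The group $\mathbb R$ acts on $\mathcal U^{s-1}$ by the constant Lorentz boosts $\Lambda_\beta f=(f_1\cosh\beta-f_2\sinh\beta,\,-f_1\sinh\beta+f_2\cosh\beta)$ and on $G^s$ by $\beta\cdot(\varphi,\alpha)=(\varphi,\alpha-2\beta)$. Let $\mathcal V^{s-1}=\mathcal U^{s-1}/\mathbb R$ with the manifold structure and the metric for which the quotient map $q:\mathcal U^{s-1}\to\mathcal V^{s-1}$, $q(f)=[f]$, is a semi-Riemannian submersion, and let $p:G^s\to K^s$, $p(\varphi,\alpha)=(\varphi,[\alpha])$. **Theorem.** Let $s>5/2$. The formulas $$\Phi(\varphi,\alpha)=\sqrt{\varphi_x}\,\bigl(\cosh(\alpha/2),\sinh(\alpha/2)\bigr),\qquad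 \Psi(\varphi,[\alpha])=[\Phi(\varphi,\alpha)]$$ define maps $\Phi:G^s\to\mathcal U^{s-1}$ and $\Psi:K^s\to\mathcal V^{s-1}$ with $\Psi\circ p=q\circ\Phi$. Both $\Phi$ and $\Psi$ are bijective isometries, i.e. diffeomorphisms whose tangent maps preserve the metrics. The actions of $\mathbb R$ on $G^s$ and $\mathcal U^{s-1}$ are equivariant with respect to $\Phi$: $\Phi(\varphi,\alpha-2\beta)=\Lambda_\beta\Phi(\varphi,\alpha)$ for all $\beta\in\mathbb R$ and $(\varphi,\alpha)\in G^s$. -/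

import Mathlib

open scoped ContDiff

noncomputable section

namespace HunterSaxton

/-! ### Sobolev spaces on the circle `ℝ / ℤ` -/

/-- The Fourier coefficients of a real function on the circle, with the Sobolev weight:
`k ↦ (1 + k²)^(s/2) f̂(k)`. -/
def sobolevCoeff (s : ℝ) : C(UnitAddCircle, ℝ) →ₗ[ℝ] (ℤ → ℂ) where
  toFun f k := (((1 + (k : ℝ) ^ 2) ^ (s / 2) : ℝ) : ℂ) * fourierCoeff (fun x => ((f x : ℝ) : ℂ)) k
  map_add' f g := by
    have hint : ∀ h : C(UnitAddCircle, ℝ), MeasureTheory.Integrable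
        (fun x => ((h x : ℝ) : ℂ)) AddCircle.haarAddCircle := fun h =>
      (Complex.continuous_ofReal.comp h.continuous).integrable_of_hasCompactSupport
        (HasCompactSupport.of_compactSpace _)
    ext k
    have := congrFun (fourierCoeff.add (hint f) (hint g)) k
    simp only [Pi.add_apply] at this ⊢
    rw [← mul_add, ← this]
    congr 2
    ext x
    simp
  map_smul' c f := by
    ext k
    have := fourierCoeff.const_smul (fun x => ((f x : ℝ) : ℂ)) (c : ℂ) k
    simp only [RingHom.id_apply, Pi.smul_apply, Complex.real_smul]
    rw [mul_left_comm]
    congr 1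
    rw [smul_eq_mul] at this
    rw [← this]
    congr 1
    ext x
    simp

/-- The continuous functions `f` with `∑ₖ (1 + k²)^s |f̂(k)|² < ∞`. For `s > 1/2` every element of
the Sobolev space `H^s(S¹)` has a unique continuous representative, so that this is `H^s(S¹)`. -/
def sobolevSubmodule (s : ℝ) : Submodule ℝ C(UnitAddCircle, ℝ) where
  carrier := {f | Memℓp (sobolevCoeff s f) 2}
  add_mem' {f g} hf hg := by
    simp only [Set.mem_ofPred_eq, map_add] at *
    exact hf.add hg
  zero_mem' := by
    simp only [Set.mem_ofPred_eq, map_zero]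
    exact zero_memℓp
  smul_mem' c f hf := by
    simp only [Set.mem_ofPred_eq, map_smul] at *
    exact hf.const_smul c

/-- The real Sobolev space `H^s(S¹)` (used for `s > 1/2`). It is a type of its own, so that it
carries the Sobolev norm and not the supremum norm. -/
def Sobolev (s : ℝ) : Type := ↥(sobolevSubmodule s)

instance (s : ℝ) : AddCommGroup (Sobolev s) :=
  inferInstanceAs (AddCommGroup ↥(sobolevSubmodule s))

instance (s : ℝ) : Module ℝ (Sobolev s) :=
  inferInstanceAs (Module ℝ ↥(sobolevSubmodule s))

/-- The underlying continuous function. -/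
def Sobolev.toC {s : ℝ} (f : Sobolev s) : C(UnitAddCircle, ℝ) := f.1

instance (s : ℝ) : CoeFun (Sobolev s) (fun _ => UnitAddCircle → ℝ) := ⟨fun f => f.toC⟩

/-- The isometric embedding of `H^s(S¹)` into `ℓ²(ℤ)` by the weighted Fourier coefficients. -/
def Sobolev.toLp (s : ℝ) : Sobolev s →ₗ[ℝ] lp (fun _ : ℤ => ℂ) 2 where
  toFun f := ⟨sobolevCoeff s f.toC, f.2⟩
  map_add' f g := Subtype.ext ((sobolevCoeff s).map_add f.toC g.toC)
  map_smul' c f := Subtype.ext ((sobolevCoeff s).map_smul c f.toC)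

theorem Sobolev.toLp_injective (s : ℝ) : Function.Injective (Sobolev.toLp s) := by
  rw [injective_iff_map_eq_zero]
  intro f hf
  have h0 : ∀ k, fourierCoeff (fun x => ((f x : ℝ) : ℂ)) k = 0 := by
    intro k
    have h1 : sobolevCoeff s f.toC k = 0 := congrFun (congrArg Subtype.val hf) k
    have h2 : (((1 + (k : ℝ) ^ 2) ^ (s / 2) : ℝ) : ℂ) ≠ 0 := by
      have : (0 : ℝ) < (1 + (k : ℝ) ^ 2) ^ (s / 2) := Real.rpow_pos_of_pos (by positivity) _
      exact_mod_cast this.ne'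
    exact (mul_eq_zero.mp h1).resolve_left h2
  obtain ⟨F, hFx⟩ : ∃ F : C(UnitAddCircle, ℂ), ∀ x, F x = ((f x : ℝ) : ℂ) :=
    ⟨⟨fun x => ((f x : ℝ) : ℂ), Complex.continuous_ofReal.comp f.toC.continuous⟩, fun _ => rfl⟩
  have hF : fourierCoeff F = 0 := by
    rw [show (F : UnitAddCircle → ℂ) = fun x => ((f x : ℝ) : ℂ) from funext hFx]
    exact funext h0
  have hs := hasSum_fourier_series_of_summable (f := F) (by rw [hF]; exact summable_zero)
  have hz : F = 0 := by
    refine hs.unique ?_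
    have : (fun i => fourierCoeff F i • (fourier i : C(UnitAddCircle, ℂ))) = fun _ => 0 := by
      ext1 i
      rw [hF, Pi.zero_apply]
      ext x
      simp
    rw [this]
    exact hasSum_zero
  have hfx : ∀ x, f x = 0 := fun x => by
    have h3 := hFx x
    rw [hz, ContinuousMap.zero_apply] at h3
    exact_mod_cast h3.symm
  exact Subtype.ext (ContinuousMap.ext hfx)

/-- The Sobolev norm `‖f‖² = ∑ₖ (1 + k²)^s |f̂(k)|²`. -/
instance (s : ℝ) : NormedAddCommGroup (Sobolev s) :=
  NormedAddCommGroup.induced (Sobolev s) (lp (fun _ : ℤ => ℂ) 2) (Sobolev.toLp s)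
    (Sobolev.toLp_injective s)

instance (s : ℝ) : NormedSpace ℝ (Sobolev s) :=
  NormedSpace.induced ℝ (Sobolev s) (lp (fun _ : ℤ => ℂ) 2) (Sobolev.toLp s)

/-- The constant function `1` in `H^s(S¹)`. -/
def Sobolev.one (s : ℝ) : Sobolev s := ⟨1, by
  have hsupp : ∀ k : ℤ, k ≠ 0 → sobolevCoeff s 1 k = 0 := by
    intro k hk
    have h1 := congrFun (fourierCoeff_fourier (T := 1) 0) k
    have h2 : (fun x : UnitAddCircle => (((1 : C(UnitAddCircle, ℝ)) x : ℝ) : ℂ))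
        = (fourier 0 : C(UnitAddCircle, ℂ)) := by
      ext x; simp
    have h3 : sobolevCoeff s 1 k = (((1 + (k : ℝ) ^ 2) ^ (s / 2) : ℝ) : ℂ) *
      fourierCoeff (fun x => (((1 : C(UnitAddCircle, ℝ)) x : ℝ) : ℂ)) k := rfl
    rw [h3, h2, h1, Pi.single_eq_of_ne hk, mul_zero]
  have h0 : Memℓp (sobolevCoeff s 1) 0 :=
    memℓp_zero ((Set.finite_singleton (0 : ℤ)).subset fun k hk => by
      by_contra hne
      exact hk (hsupp k hne))
  exact h0.of_exponent_ge bot_le⟩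

/-- The constant functions in `H^s(S¹)`. -/
def constants (s : ℝ) : Submodule ℝ (Sobolev s) := Submodule.span ℝ {Sobolev.one s}

instance (s : ℝ) : IsClosed (constants s : Set (Sobolev s)) := by
  have : FiniteDimensional ℝ (constants s) := by unfold constants; infer_instance
  exact Submodule.closed_of_finiteDimensional _

/-- `H^s(S¹) / ℝ`: functions of class `H^s` up to additive constants, with the quotient norm. -/
abbrev SobolevModConst (s : ℝ) : Type := Sobolev s ⧸ constants s

/-- `H₀^s(S¹)`: the functions `u` of class `H^s` with `u(0) = 0`. -/
def sobolevZero (s : ℝ) : Submodule ℝ (Sobolev s) where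
  carrier := {u | u 0 = 0}
  add_mem' {u v} hu hv := by
    change u.toC 0 + v.toC 0 = 0
    have h1 : u.toC 0 = 0 := hu
    have h2 : v.toC 0 = 0 := hv
    rw [h1, h2, add_zero]
  zero_mem' := rfl
  smul_mem' c u hu := by
    change c * u.toC 0 = 0
    have h1 : u.toC 0 = 0 := hu
    rw [h1, mul_zero]

/-- The derivative `u_x` of a function on the circle. -/
def circleDeriv (u : UnitAddCircle → ℝ) (x : UnitAddCircle) : ℝ :=
  deriv (fun t : ℝ => u (x + (t : UnitAddCircle))) 0

/-! ### The groups `Diff₀^s(S¹)`, `G^s`, `K^s` and their metrics -/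

/-- The derivative `φ_x = 1 + v_x` of `φ = id + v`. -/
def phiDeriv {s : ℝ} (v : sobolevZero s) (x : UnitAddCircle) : ℝ :=
  1 + circleDeriv (v : Sobolev s) x

/-- `Diff₀^s(S¹)`: the orientation-preserving diffeomorphisms `φ` of the circle of class `H^s` with
`φ(0) = 0`. Such a `φ` is written uniquely as `φ(x) = x + v(x)` with `v ∈ H₀^s(S¹)`, and it is
identified with `v`; this is the global chart of `Diff₀^s(S¹)`. -/
def Diff0 (s : ℝ) : Set (sobolevZero s) :=
  {v | Function.Bijective
        (fun x : UnitAddCircle => x + (((v : Sobolev s) x : ℝ) : UnitAddCircle)) ∧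
      ∀ x, 0 < phiDeriv v x}

/-- The space `H₀^s × H^{s-1}` in which `G^s` is open; it is every tangent space of `G^s`. -/
abbrev TG (s : ℝ) : Type := sobolevZero s × Sobolev (s - 1)

/-- The space `H₀^s × (H^{s-1}/ℝ)` in which `K^s` is open; it is every tangent space of `K^s`. -/
abbrev TK (s : ℝ) : Type := sobolevZero s × SobolevModConst (s - 1)

/-- The manifold `G^s = Diff₀^s(S¹) × H^{s-1}(S¹)` of pairs `(φ, α)`. -/
def G (s : ℝ) : Set (TG s) := {g | g.1 ∈ Diff0 s}

/-- The manifold `K^s = Diff₀^s(S¹) × (H^{s-1}(S¹)/ℝ)` of pairs `(φ, [α])`. -/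
def K (s : ℝ) : Set (TK s) := {a | a.1 ∈ Diff0 s}

/-- The quotient map `p(φ, α) = (φ, [α])`. -/
def p (s : ℝ) (g : G s) : K s := ⟨(g.1.1, Submodule.Quotient.mk g.1.2), g.2⟩

/-- The metric `¼ ∫ (U₁ₓ V₁ₓ / φₓ - U₂ V₂ φₓ) dx` of `G^s` at the point `(φ, α)`. -/
def metricG (s : ℝ) (g U V : TG s) : ℝ :=
  (1 / 4) * ∫ x : UnitAddCircle,
    (circleDeriv (U.1 : Sobolev s) x * circleDeriv (V.1 : Sobolev s) x / phiDeriv g.1 x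
      - U.2 x * V.2 x * phiDeriv g.1 x)

/-- The projection `π([U₂]) = U₂ - ∫ U₂ φₓ dx` at the point `φ = id + v` of `Diff₀^s(S¹)`. It does
not depend on the chosen representative of the class, because `∫ φₓ dx = 1`. -/
def piProj {s : ℝ} (v : sobolevZero s) (U₂ : SobolevModConst (s - 1)) (x : UnitAddCircle) : ℝ :=
  (Quotient.out U₂ : Sobolev (s - 1)) x
    - ∫ y : UnitAddCircle, (Quotient.out U₂ : Sobolev (s - 1)) y * phiDeriv v y

/-- The metric `¼ ∫ (U₁ₓ V₁ₓ / φₓ - π(U₂) π(V₂) φₓ) dx` of `K^s` at the point `(φ, [α])`. -/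
def metricK (s : ℝ) (a U V : TK s) : ℝ :=
  (1 / 4) * ∫ x : UnitAddCircle,
    (circleDeriv (U.1 : Sobolev s) x * circleDeriv (V.1 : Sobolev s) x / phiDeriv a.1 x
      - piProj a.1 U.2 x * piProj a.1 V.2 x * phiDeriv a.1 x)

/-! ### The pseudosphere, its open part `U^r`, and the Lorentz boosts -/

/-- The space `H^r(S¹; ℝ²)`. -/
abbrev Pair (r : ℝ) : Type := Sobolev r × Sobolev r

/-- The indefinite product `⟪X, Y⟫ = ∫ (X₁ Y₁ - X₂ Y₂) dx`. -/
def pairing (r : ℝ) (X Y : Pair r) : ℝ :=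
  ∫ x : UnitAddCircle, (X.1 x * Y.1 x - X.2 x * Y.2 x)

/-- The unit pseudosphere of class `H^r`. -/
def PseudoSphere (r : ℝ) : Set (Pair r) :=
  {f | ∫ x : UnitAddCircle, ((f.1 x) ^ 2 - (f.2 x) ^ 2) = 1}

/-- The open subset `U^r` of the pseudosphere. -/
def U (r : ℝ) : Set (Pair r) :=
  {f | f ∈ PseudoSphere r ∧ ∀ x, 0 < f.1 x ∧ 0 < (f.1 x) ^ 2 - (f.2 x) ^ 2}

/-- The metric of `U^r` at `f`: the restriction of the indefinite product. -/
def metricU (r : ℝ) (_f X Y : Pair r) : ℝ := pairing r X Y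

/-- The Lorentz boost `Λ_β` with constant rapidity `β`. -/
def boost (r β : ℝ) (f : Pair r) : Pair r :=
  (Real.cosh β • f.1 - Real.sinh β • f.2, -Real.sinh β • f.1 + Real.cosh β • f.2)

theorem boost_fst (r β : ℝ) (f : Pair r) (x : UnitAddCircle) :
    (boost r β f).1 x = Real.cosh β * f.1 x - Real.sinh β * f.2 x := rfl

theorem boost_snd (r β : ℝ) (f : Pair r) (x : UnitAddCircle) :
    (boost r β f).2 x = -Real.sinh β * f.1 x + Real.cosh β * f.2 x := rfl

theorem boost_zero (r : ℝ) (f : Pair r) : boost r 0 f = f := by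
  simp [boost]

theorem boost_add (r β γ : ℝ) (f : Pair r) : boost r (β + γ) f = boost r β (boost r γ f) := by
  refine Prod.ext ?_ ?_
  · simp only [boost, Real.cosh_add, Real.sinh_add]
    module
  · simp only [boost, Real.cosh_add, Real.sinh_add]
    module

theorem pairing_boost (r β : ℝ) (X Y : Pair r) :
    pairing r (boost r β X) (boost r β Y) = pairing r X Y := by
  unfold pairing
  congr 1
  ext x
  simp only [boost_fst, boost_snd]
  linear_combination (X.1 x * Y.1 x - X.2 x * Y.2 x) * Real.cosh_sq β

theorem boost_mem (r β : ℝ) {f : Pair r} (hf : f ∈ U r) : boost r β f ∈ U r := by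
  have key : ∀ x, ((boost r β f).1 x) ^ 2 - ((boost r β f).2 x) ^ 2
      = (f.1 x) ^ 2 - (f.2 x) ^ 2 := by
    intro x
    simp only [boost_fst, boost_snd]
    linear_combination ((f.1 x) ^ 2 - (f.2 x) ^ 2) * Real.cosh_sq β
  refine ⟨?_, fun x => ⟨?_, ?_⟩⟩
  · change ∫ x, _ = _
    simp only [key]
    exact hf.1
  · rw [boost_fst]
    obtain ⟨h1, h2⟩ := hf.2 x
    have h3 : |f.2 x| < f.1 x := abs_lt_of_sq_lt_sq (by linarith) h1.le
    have h4 : |Real.sinh β| < Real.cosh β :=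
      abs_lt_of_sq_lt_sq (by linarith [Real.cosh_sq β]) (Real.cosh_pos β).le
    have h5 : |Real.sinh β * f.2 x| < Real.cosh β * f.1 x := by
      rw [abs_mul]
      exact mul_lt_mul'' h4 h3 (abs_nonneg _) (abs_nonneg _)
    linarith [le_abs_self (Real.sinh β * f.2 x)]
  · rw [key]
    exact (hf.2 x).2

/-- The action `(β, f) ↦ Λ_β f` of `ℝ` on `U^r`. -/
instance (r : ℝ) : AddAction ℝ (U r) where
  vadd β f := ⟨boost r β f.1, boost_mem r β f.2⟩
  zero_vadd f := Subtype.ext (boost_zero r f.1)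
  add_vadd β γ f := Subtype.ext (boost_add r β γ f.1)

/-- The action `(β, (φ, α)) ↦ (φ, α - 2β)` of `ℝ` on `G^s`. -/
instance (s : ℝ) : AddAction ℝ (G s) where
  vadd β g := ⟨(g.1.1, g.1.2 - (2 * β) • Sobolev.one (s - 1)), g.2⟩
  zero_vadd g := Subtype.ext (Prod.ext rfl (by
    change g.1.2 - ((2 : ℝ) * 0) • Sobolev.one (s - 1) = g.1.2
    simp))
  add_vadd β γ g := Subtype.ext (Prod.ext rfl (by
    change g.1.2 - (2 * (β + γ)) • Sobolev.one (s - 1)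
      = g.1.2 - (2 * γ) • Sobolev.one (s - 1) - (2 * β) • Sobolev.one (s - 1)
    module))

/-- The quotient space `V^r = U^r / ℝ` by the constant Lorentz boosts. -/
abbrev V (r : ℝ) : Type := AddAction.orbitRel.Quotient ℝ (U r)

/-- The quotient map `q : U^r → V^r`. -/
def q (r : ℝ) (f : U r) : V r := Quotient.mk (AddAction.orbitRel ℝ (U r)) f

/-- The direction of the orbit through `f`: the derivative of `Λ_β f` at `β = 0`. If `f ∈ U^r`, it
is tangent to `U^r`, and its product with itself is `-1`. -/
def vertical (r : ℝ) (f : Pair r) : Pair r := (-f.2, -f.1)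

/-- The horizontal part `X + ⟪X, N⟫ N`, where `N` is the orbit direction: the component of `X` that
is orthogonal to the orbit through `f`. -/
def horizontal (r : ℝ) (f X : Pair r) : Pair r :=
  X + pairing r X (vertical r f) • vertical r f

/-- The metric of `V^r` at `[f]`, the one that makes `q` a semi-Riemannian submersion. A tangent
vector of `V^r` at `[f]` is the image under the tangent map of `q` of some `X` tangent to `U^r` at
`f`, and the value on the images of `X` and `Y` is the product of the horizontal parts of `X` and
`Y`. By `metricV_add_vertical` and `metricV_boost` it depends on nothing else. -/
def metricV (r : ℝ) (f X Y : Pair r) : ℝ :=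
  pairing r (horizontal r f X) (horizontal r f Y)

theorem pairing_integrable (r : ℝ) (X Y : Pair r) : MeasureTheory.Integrable
    (fun x : UnitAddCircle => X.1 x * Y.1 x - X.2 x * Y.2 x) :=
  (((X.1.toC.continuous.mul Y.1.toC.continuous).sub
    (X.2.toC.continuous.mul Y.2.toC.continuous))).integrable_of_hasCompactSupport
      (HasCompactSupport.of_compactSpace _)

theorem pairing_add_smul (r c : ℝ) (X Z Y : Pair r) :
    pairing r (X + c • Z) Y = pairing r X Y + c * pairing r Z Y := by
  unfold pairing
  rw [← MeasureTheory.integral_const_mul, ← MeasureTheory.integral_add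
    (pairing_integrable r X Y) ((pairing_integrable r Z Y).const_mul c)]
  congr 1
  ext x
  change (X.1.toC x + c * Z.1.toC x) * Y.1.toC x - (X.2.toC x + c * Z.2.toC x) * Y.2.toC x = _
  ring

theorem pairing_vertical (r : ℝ) {f : Pair r} (hf : f ∈ U r) :
    pairing r (vertical r f) (vertical r f) = -1 := by
  have h : pairing r (vertical r f) (vertical r f)
      = -∫ x : UnitAddCircle, ((f.1 x) ^ 2 - (f.2 x) ^ 2) := by
    unfold pairing
    rw [← MeasureTheory.integral_neg]
    congr 1
    ext x
    change (-f.2.toC x) * (-f.2.toC x) - (-f.1.toC x) * (-f.1.toC x) = _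
    ring
  rw [h, hf.1]

theorem horizontal_add_vertical (r c : ℝ) {f : Pair r} (hf : f ∈ U r) (X : Pair r) :
    horizontal r f (X + c • vertical r f) = horizontal r f X := by
  unfold horizontal
  rw [pairing_add_smul, pairing_vertical r hf]
  module

/-- The metric of `V^r` sees tangent vectors of `U^r` only modulo the orbit direction. -/
theorem metricV_add_vertical (r c d : ℝ) {f : Pair r} (hf : f ∈ U r) (X Y : Pair r) :
    metricV r f (X + c • vertical r f) (Y + d • vertical r f) = metricV r f X Y := by
  unfold metricV
  rw [horizontal_add_vertical r c hf, horizontal_add_vertical r d hf]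

theorem horizontal_boost (r β : ℝ) (f X : Pair r) :
    horizontal r (boost r β f) (boost r β X) = boost r β (horizontal r f X) := by
  have h : vertical r (boost r β f) = boost r β (vertical r f) := by
    refine Prod.ext ?_ ?_
    · simp only [vertical, boost]; module
    · simp only [vertical, boost]; module
  unfold horizontal
  rw [h, pairing_boost]
  refine Prod.ext ?_ ?_
  · simp only [boost, Prod.fst_add, Prod.snd_add, Prod.smul_fst, Prod.smul_snd]; module
  · simp only [boost, Prod.fst_add, Prod.snd_add, Prod.smul_fst, Prod.smul_snd]; module

/-- The metric of `V^r` does not depend on the point of the orbit at which it is computed. -/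
theorem metricV_boost (r β : ℝ) (f X Y : Pair r) :
    metricV r (boost r β f) (boost r β X) (boost r β Y) = metricV r f X Y := by
  unfold metricV
  rw [horizontal_boost, horizontal_boost, pairing_boost]

/-! ### Smooth maps and isometries

`A` and `B` are submanifolds of normed spaces `E` and `F` (for example open subsets), and
`π : B → Q` is the identity or, more generally, the projection of `B` onto the quotient manifold `Q`
(the one for which `π` is a surjective submersion). -/

variable {E F Q : Type*} [NormedAddCommGroup E] [NormedSpace ℝ E]
  [NormedAddCommGroup F] [NormedSpace ℝ F]

/-- `g : E → F` represents `f : A → Q` near the point `a` of `A`: it is smooth on an open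
neighbourhood `W` of `a`, maps `A ∩ W` into `B`, and `π ∘ g = f` there. -/
def IsLocalLift {A : Set E} {B : Set F} (π : B → Q) (f : A → Q) (a : A) (g : E → F) : Prop :=
  ∃ W : Set E, IsOpen W ∧ (a : E) ∈ W ∧ ContDiffOn ℝ ∞ g W ∧
    ∀ b : A, (b : E) ∈ W → ∃ hb : g b ∈ B, π ⟨g b, hb⟩ = f b

/-- `f : A → Q` is smooth: near every point it has a smooth representative. For `Q = B` and `π = id`
this is smoothness of a map between submanifolds. For a submersion `π` it is smoothness into the
quotient manifold, as submersions have smooth local sections. -/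
def IsSmoothMap {A : Set E} {B : Set F} (π : B → Q) (f : A → Q) : Prop :=
  ∀ a : A, ∃ g : E → F, IsLocalLift π f a g

/-- `f : A → Q` is a bijective isometry of the pseudo-Riemannian manifold `A`, an open subset of `E`
with metric `gA`, onto the pseudo-Riemannian manifold `Q`: it is a diffeomorphism and its tangent
map preserves the metric. The metric of `Q` is given by `gB`, that is, `gB b X Y` is the value at
`π(b)` on the images under the tangent map of `π` of the vectors `X` and `Y` tangent to `B` at `b`.
A map out of `Q` is smooth iff its composition with `π` is smooth. If `g` represents `f` near `a`,
the tangent map of `f` at `a` maps `X` to the image of `Dg(a) X` under the tangent map of `π`. -/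
structure IsBijectiveIsometry {A : Set E} {B : Set F} (gA : E → E → E → ℝ) (gB : F → F → F → ℝ)
    (π : B → Q) (f : A → Q) : Prop where
  isOpen_domain : IsOpen A
  bijective : Function.Bijective f
  smooth : IsSmoothMap π f
  smooth_inverse : ∃ h : Q → A, Function.LeftInverse h f ∧ Function.RightInverse h f ∧
    IsSmoothMap (id : A → A) (h ∘ π)
  metric_eq : ∀ (a : A) (g : E → F), IsLocalLift π f a g → ∀ X Y : E,
    gB (g a) (fderiv ℝ g a X) (fderiv ℝ g a Y) = gA a X Y

end HunterSaxton

end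

/-! In light-cone coordinates `Φ` is elementary: `f₁ ± f₂ = √φₓ exp(±α/2)`. The product of the two
factors is `f₁² - f₂² = φₓ`, whose mean is 1 because `φ - id` is periodic, and the difference of
their logarithms is `α`. Hence `φ` is recovered as a primitive of `f₁² - f₂²` and `α` as `log (f₁ +
f₂) - log (f₁ - f₂)`. A boost multiplies the two factors by `exp(∓β)`, which is the shift of `α` by
`-2β`. So orbits of boosts correspond to classes of `α` modulo constants, and `Ψ` is well defined
and bijective (`q_Phi_eq_iff`).

For the metrics, let `Y` be the image of `(U₁, U₂)`. Differentiating the two recovery formulas gives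
`U₁ₓ = 2 (f₁ Y₁ - f₂ Y₂)` and `U₂ φₓ = 2 (f₁ Y₂ - f₂ Y₁)`. The isometry is then the pointwise
identity `isometry_identity`, the multiplicativity of the Lorentz form under split-complex
multiplication. On the quotient, the product of `Y` with the orbit direction is half of `∫ U₂ φₓ`,
so removing the mean by `π` is the same as passing to the horizontal part (`piProj_mul_phiDeriv`).

The analytic content is that these formulas are smooth between Sobolev spaces. On the Fourier side
`H^r` is a complete algebra for `r > 1/2` (`completeSpace`, `exists_mul`), so the exponential series
converges and is smooth. A positive function has its logarithm in `H^r` because the spectral radius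
is bounded by the supremum norm (`summable_norm_pow`, `exists_log`), and the logarithm is smooth by
the inverse function theorem. Derivative and primitive are Fourier multipliers. -/

noncomputable section

namespace HunterSaxton

open MeasureTheory Filter Topology

/-! ### Fourier coefficients of Sobolev functions -/

/-- The Sobolev weight `(1 + k²)^(s/2)`. -/
def sobolevWeight (s : ℝ) (k : ℤ) : ℝ := (1 + (k : ℝ) ^ 2) ^ (s / 2)

theorem sobolevWeight_pos (s : ℝ) (k : ℤ) : 0 < sobolevWeight s k :=
  Real.rpow_pos_of_pos (by positivity) _

theorem sobolevWeight_sq (s : ℝ) (k : ℤ) : sobolevWeight s k ^ 2 = (1 + (k : ℝ) ^ 2) ^ s := by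
  unfold sobolevWeight
  rw [← Real.rpow_natCast, ← Real.rpow_mul (by positivity)]
  congr 1
  push_cast
  ring

theorem sobolevWeight_neg (s : ℝ) (k : ℤ) : sobolevWeight s (-k) = sobolevWeight s k := by
  simp [sobolevWeight]

theorem summable_inv_sobolevWeight_sq {s : ℝ} (hs : 1 / 2 < s) :
    Summable fun k : ℤ => (sobolevWeight s k ^ 2)⁻¹ := by
  have h1 : Summable fun k : ℤ => |(k : ℝ)| ^ (-(2 * s)) :=
    Real.summable_abs_int_rpow (by linarith)
  -- The comparison with `|k|^(-2s)` fails at `k = 0`, so the term there is dominated separately.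
  have h2 : Summable (Pi.single (0 : ℤ) (1 : ℝ)) := (hasSum_pi_single 0 (1 : ℝ)).summable
  refine Summable.of_nonneg_of_le (fun k => by positivity) (fun k => ?_) (h1.add h2)
  rw [sobolevWeight_sq]
  by_cases hk : k = 0
  · subst hk
    simp only [Int.cast_zero, Pi.single_eq_same]
    have : (0 : ℝ) ≤ |(0 : ℝ)| ^ (-(2 * s)) := by positivity
    simpa using this
  · have hk' : 0 < |(k : ℝ)| := by positivity
    rw [Pi.single_eq_of_ne hk, add_zero, ← Real.rpow_neg (by positivity),
      show -(2 * s) = 2 * (-s) by ring, Real.rpow_mul (abs_nonneg _)]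
    have : |(k : ℝ)| ^ (2 : ℝ) = (k : ℝ) ^ 2 := by
      rw [Real.rpow_two, sq_abs]
    rw [this]
    exact Real.rpow_le_rpow_of_nonpos (by positivity) (by linarith) (by linarith)

namespace Sobolev

/-- The Fourier coefficients of a Sobolev function. -/
def coeff {s : ℝ} (f : Sobolev s) (k : ℤ) : ℂ := fourierCoeff (fun x => ((f x : ℝ) : ℂ)) k

theorem toLp_apply {s : ℝ} (f : Sobolev s) (k : ℤ) :
    (Sobolev.toLp s f : ℤ → ℂ) k = (sobolevWeight s k : ℂ) * f.coeff k := rfl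

@[simp] theorem add_apply {s : ℝ} (f g : Sobolev s) (x : UnitAddCircle) :
    (f + g) x = f x + g x := rfl

@[simp] theorem sub_apply {s : ℝ} (f g : Sobolev s) (x : UnitAddCircle) :
    (f - g) x = f x - g x := rfl

@[simp] theorem neg_apply {s : ℝ} (f : Sobolev s) (x : UnitAddCircle) : (-f) x = -f x := rfl

@[simp] theorem smul_apply {s : ℝ} (c : ℝ) (f : Sobolev s) (x : UnitAddCircle) :
    (c • f) x = c * f x := rfl

@[simp] theorem one_apply (s : ℝ) (x : UnitAddCircle) : Sobolev.one s x = 1 := rfl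

theorem ext_apply {s : ℝ} {f g : Sobolev s} (h : ∀ x, f x = g x) : f = g :=
  Subtype.ext (ContinuousMap.ext h)

theorem coeff_add {s : ℝ} (f g : Sobolev s) (k : ℤ) : (f + g).coeff k = f.coeff k + g.coeff k := by
  have h := congrFun (congrArg Subtype.val ((toLp s).map_add f g)) k
  have h' : (sobolevWeight s k : ℂ) * (f + g).coeff k
    = (sobolevWeight s k : ℂ) * f.coeff k + (sobolevWeight s k : ℂ) * g.coeff k := h
  have hw : (sobolevWeight s k : ℂ) ≠ 0 := by exact_mod_cast (sobolevWeight_pos s k).ne'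
  exact mul_left_cancel₀ hw (by rw [h', mul_add])

theorem coeff_smul {s : ℝ} (c : ℝ) (f : Sobolev s) (k : ℤ) :
    (c • f).coeff k = c * f.coeff k := by
  have h := congrFun (congrArg Subtype.val ((toLp s).map_smul c f)) k
  have h' : (sobolevWeight s k : ℂ) * (c • f).coeff k
    = c • ((sobolevWeight s k : ℂ) * f.coeff k) := h
  have hw : (sobolevWeight s k : ℂ) ≠ 0 := by exact_mod_cast (sobolevWeight_pos s k).ne'
  refine mul_left_cancel₀ hw ?_
  rw [h', Complex.real_smul]
  ring

theorem coeff_sub {s : ℝ} (f g : Sobolev s) (k : ℤ) : (f - g).coeff k = f.coeff k - g.coeff k := by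
  rw [eq_sub_iff_add_eq, ← coeff_add, sub_add_cancel]

theorem ext_coeff {s : ℝ} {f g : Sobolev s} (h : ∀ k, f.coeff k = g.coeff k) : f = g :=
  toLp_injective s (Subtype.ext (funext fun k => by rw [toLp_apply, toLp_apply, h k]))

theorem hasSum_norm_sq {s : ℝ} (f : Sobolev s) :
    HasSum (fun k => (sobolevWeight s k * ‖f.coeff k‖) ^ 2) (‖f‖ ^ 2) := by
  have h := lp.hasSum_norm (p := 2) (by norm_num) (toLp s f)
  simp only [ENNReal.toReal_ofNat, Real.rpow_two] at h
  change HasSum _ (‖toLp s f‖ ^ 2)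
  convert h using 2 with k
  rw [toLp_apply, norm_mul, Complex.norm_real, Real.norm_of_nonneg (sobolevWeight_pos s k).le]

theorem norm_le_of_hasSum {s : ℝ} {f : Sobolev s} {a : ℤ → ℝ} {C : ℝ} (hC : 0 ≤ C)
    (h : HasSum a (C ^ 2)) (hf : ∀ k, (sobolevWeight s k * ‖f.coeff k‖) ^ 2 ≤ a k) : ‖f‖ ≤ C :=
  (sq_le_sq₀ (norm_nonneg _) hC).mp (hasSum_le hf (hasSum_norm_sq f) h)

/-- Real-valuedness seen on the Fourier side; with the weighted square summability it characterises
the coefficient sequences. -/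
theorem coeff_neg {s : ℝ} (f : Sobolev s) (k : ℤ) :
    f.coeff (-k) = starRingEnd ℂ (f.coeff k) := by
  unfold coeff fourierCoeff
  rw [← integral_conj]
  congr 1
  ext x
  simp

/-- Summability of the Fourier coefficients, with the bound given by the Cauchy-Schwarz
inequality. -/
theorem summable_mul_coeff {s : ℝ} (f : Sobolev s) {a : ℤ → ℝ} (ha : ∀ k, 0 ≤ a k)
    (h : Summable fun k => (a k / sobolevWeight s k) ^ 2) :
    (Summable fun k => a k * ‖f.coeff k‖) ∧
      ∑' k, a k * ‖f.coeff k‖ ≤ √(∑' k, (a k / sobolevWeight s k) ^ 2) * ‖f‖ := by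
  have hf := hasSum_norm_sq f
  have e : ∀ k, a k * ‖f.coeff k‖
      = (a k / sobolevWeight s k) * (sobolevWeight s k * ‖f.coeff k‖) := fun k => by
    have := (sobolevWeight_pos s k).ne'
    field_simp
  have h0 : ∀ k, 0 ≤ a k / sobolevWeight s k :=
    fun k => div_nonneg (ha k) (sobolevWeight_pos s k).le
  have h0' : ∀ k, 0 ≤ sobolevWeight s k * ‖f.coeff k‖ :=
    fun k => mul_nonneg (sobolevWeight_pos s k).le (norm_nonneg _)
  have hp : Real.HolderConjugate 2 2 := Real.HolderConjugate.two_two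
  simp only [e]
  refine ⟨Real.summable_mul_of_Lp_Lq_of_nonneg hp h0 h0' (by simpa using h)
    (by simpa using hf.summable), ?_⟩
  have := Real.inner_le_Lp_mul_Lq_tsum_of_nonneg hp h0 h0' (by simpa using h)
    (by simpa using hf.summable)
  simp only [Real.rpow_two] at this
  rwa [hf.tsum_eq, ← Real.sqrt_eq_rpow, ← Real.sqrt_eq_rpow, Real.sqrt_sq (norm_nonneg _)] at this

theorem summable_coeff {s : ℝ} (hs : 1 / 2 < s) (f : Sobolev s) :
    Summable fun k => ‖f.coeff k‖ := by
  have := (summable_mul_coeff f (a := fun _ => 1) (fun _ => zero_le_one)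
    (by simpa using summable_inv_sobolevWeight_sq hs)).1
  simpa using this

/-- The function as a continuous complex function. -/
def toCC {s : ℝ} (f : Sobolev s) : C(UnitAddCircle, ℂ) :=
  ⟨fun x => ((f x : ℝ) : ℂ), Complex.continuous_ofReal.comp f.toC.continuous⟩

@[simp] theorem toCC_apply {s : ℝ} (f : Sobolev s) (x : UnitAddCircle) :
    f.toCC x = ((f x : ℝ) : ℂ) := rfl

theorem fourierCoeff_toCC {s : ℝ} (f : Sobolev s) (k : ℤ) : fourierCoeff f.toCC k = f.coeff k := rfl

theorem hasSum_toCC {s : ℝ} (hs : 1 / 2 < s) (f : Sobolev s) :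
    HasSum (fun k => f.coeff k • (fourier k : C(UnitAddCircle, ℂ))) f.toCC :=
  hasSum_fourier_series_of_summable (f := f.toCC) (summable_coeff hs f).of_norm

theorem hasSum_apply {s : ℝ} (hs : 1 / 2 < s) (f : Sobolev s) (x : UnitAddCircle) :
    HasSum (fun k => f.coeff k * fourier k x) ((f x : ℝ) : ℂ) := by
  exact has_pointwise_sum_fourier_series_of_summable (f := f.toCC)
    (summable_coeff hs f).of_norm x

/-- The constant of the Sobolev embedding `H^s ⊂ C`. -/
def embConst (s : ℝ) : ℝ := √(∑' k, (sobolevWeight s k ^ 2)⁻¹)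

theorem embConst_nonneg (s : ℝ) : 0 ≤ embConst s := Real.sqrt_nonneg _

theorem abs_apply_le {s : ℝ} (hs : 1 / 2 < s) (f : Sobolev s) (x : UnitAddCircle) :
    |f x| ≤ embConst s * ‖f‖ := by
  have h1 := (summable_mul_coeff f (a := fun _ => 1) (fun _ => zero_le_one)
    (by simpa using summable_inv_sobolevWeight_sq hs)).2
  simp only [one_mul, one_div, inv_pow] at h1
  refine le_trans ?_ h1
  have h2 := hasSum_apply hs f x
  have h3 : |f x| = ‖((f x : ℝ) : ℂ)‖ := by rw [Complex.norm_real, Real.norm_eq_abs]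
  rw [h3, ← h2.tsum_eq]
  refine (norm_tsum_le_tsum_norm ?_).trans_eq ?_
  · simpa only [norm_mul, fourier_apply, Circle.norm_coe, mul_one] using summable_coeff hs f
  · simp only [norm_mul, fourier_apply, Circle.norm_coe, mul_one]

/-- Evaluation at a point. -/
def ev {s : ℝ} (hs : 1 / 2 < s) (x : UnitAddCircle) : Sobolev s →L[ℝ] ℝ :=
  LinearMap.mkContinuous
    { toFun := fun f => f x, map_add' := fun _ _ => rfl, map_smul' := fun _ _ => rfl }
    (embConst s) (fun f => abs_apply_le hs f x)

@[simp] theorem ev_apply {s : ℝ} (hs : 1 / 2 < s) (x : UnitAddCircle) (f : Sobolev s) :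
    ev hs x f = f x := rfl

theorem norm_fourierCoeff_le (F : C(UnitAddCircle, ℂ)) (k : ℤ) : ‖fourierCoeff F k‖ ≤ ‖F‖ := by
  refine (norm_integral_le_of_norm_le_const (C := ‖F‖)
    (Filter.Eventually.of_forall fun x => ?_)).trans_eq (by simp)
  rw [norm_smul, fourier_apply, Circle.norm_coe, one_mul]
  exact F.norm_coe_le_norm x

/-- The `k`-th Fourier coefficient as a continuous linear functional. -/
def fourierCoeffCLM (k : ℤ) : C(UnitAddCircle, ℂ) →L[ℂ] ℂ :=
  LinearMap.mkContinuous
    { toFun := fun F => fourierCoeff F k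
      map_add' := fun F G => congrFun (fourierCoeff.add
        (F.continuous.integrable_of_hasCompactSupport (HasCompactSupport.of_compactSpace _))
        (G.continuous.integrable_of_hasCompactSupport (HasCompactSupport.of_compactSpace _))) k
      map_smul' := fun a F => fourierCoeff.const_smul F a k } 1 (fun F => by
        rw [one_mul]
        exact norm_fourierCoeff_le F k)

theorem fourierCoeffCLM_apply (k : ℤ) (F : C(UnitAddCircle, ℂ)) :
    fourierCoeffCLM k F = fourierCoeff F k := rfl

/-- The series converges uniformly, so the continuous coefficient functional acts term by term, and
the characters are orthonormal. -/
theorem fourierCoeff_of_hasSum {F : C(UnitAddCircle, ℂ)} {c : ℤ → ℂ}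
    (h : HasSum (fun k => c k • (fourier k : C(UnitAddCircle, ℂ))) F) (k : ℤ) :
    fourierCoeff F k = c k := by
  have h1 := h.mapL (fourierCoeffCLM k)
  have h2 : ∀ j, fourierCoeffCLM k (c j • (fourier j : C(UnitAddCircle, ℂ)))
      = if j = k then c k else 0 := by
    intro j
    have : fourierCoeffCLM k (fourier j : C(UnitAddCircle, ℂ)) = (Pi.single j 1 : ℤ → ℂ) k := by
      rw [← fourierCoeff_fourier (T := 1) j]; rfl
    rw [map_smul, this]
    by_cases hj : j = k
    · subst hj; simp
    · rw [Pi.single_eq_of_ne (Ne.symm hj)]; simp [hj]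
  simp only [h2] at h1
  exact h1.unique (hasSum_ite_eq k (c k))

/-- A Sobolev function can be prescribed by its Fourier coefficients. -/
theorem exists_coeff {s : ℝ} (hs : 1 / 2 < s) {c : ℤ → ℂ}
    (hc : ∀ k, c (-k) = starRingEnd ℂ (c k))
    (h : Summable fun k => (sobolevWeight s k * ‖c k‖) ^ 2) :
    ∃ f : Sobolev s, ∀ k, f.coeff k = c k := by
  have hsum : Summable fun k => ‖c k‖ := by
    have := Real.summable_mul_of_Lp_Lq_of_nonneg Real.HolderConjugate.two_two
      (f := fun k => (sobolevWeight s k)⁻¹) (g := fun k => sobolevWeight s k * ‖c k‖)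
      (fun k => inv_nonneg.mpr (sobolevWeight_pos s k).le)
      (fun k => mul_nonneg (sobolevWeight_pos s k).le (norm_nonneg _))
      (by simpa using summable_inv_sobolevWeight_sq hs) (by simpa using h)
    refine this.congr fun k => ?_
    have := (sobolevWeight_pos s k).ne'
    field_simp
  have hS : Summable fun k => c k • (fourier k : C(UnitAddCircle, ℂ)) :=
    Summable.of_norm (by simpa [norm_smul, fourier_norm] using hsum)
  obtain ⟨F, hF⟩ := hS
  have hreal : ∀ x, starRingEnd ℂ (F x) = F x := by
    intro x
    have hx : HasSum (fun k => c k * fourier k x) (F x) := by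
      simpa using hF.mapL (ContinuousMap.evalCLM ℂ x)
    have h1 : HasSum (fun k => starRingEnd ℂ (c k * fourier k x)) (starRingEnd ℂ (F x)) :=
      hx.map (starRingEnd ℂ) Complex.continuous_conj
    have h2 := (Equiv.neg ℤ).hasSum_iff.mpr hx
    have h3 : (fun k => starRingEnd ℂ (c k * fourier k x))
        = (fun k => c k * fourier k x) ∘ Equiv.neg ℤ := by
      funext k
      -- Conjugation only permutes the terms by `k ↦ -k`, so the sum is its own conjugate.
      simp only [Function.comp_apply, Equiv.neg_apply, map_mul, hc, fourier_neg]
    refine h1.unique ?_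
    rwa [h3]
  have hre : (fun x => (((F x).re : ℝ) : ℂ)) = F :=
    funext fun x => Complex.conj_eq_iff_re.mp (hreal x)
  let f : C(UnitAddCircle, ℝ) := ⟨fun x => (F x).re, Complex.continuous_re.comp F.continuous⟩
  have hcf : ∀ k, fourierCoeff (fun x => ((f x : ℝ) : ℂ)) k = c k := by
    intro k
    change fourierCoeff (fun x => (((F x).re : ℝ) : ℂ)) k = c k
    rw [hre]
    exact fourierCoeff_of_hasSum hF k
  have hmem : f ∈ sobolevSubmodule s := by
    refine (memℓp_gen_iff (by norm_num)).mpr ?_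
    simp only [ENNReal.toReal_ofNat, Real.rpow_two]
    refine h.congr fun k => ?_
    change _ = ‖(sobolevWeight s k : ℂ) * fourierCoeff (fun x => ((f x : ℝ) : ℂ)) k‖ ^ 2
    rw [hcf, norm_mul, Complex.norm_real, Real.norm_of_nonneg (sobolevWeight_pos s k).le]
  exact ⟨⟨f, hmem⟩, hcf⟩

/-- The weighted coefficients embed `H^s` isometrically onto the sequences in `ℓ²` with the
conjugation symmetry, a closed condition. Completeness is needed for the exponential and logarithm
series and for the inverse function theorem. -/
theorem completeSpace {s : ℝ} (hs : 1 / 2 < s) : CompleteSpace (Sobolev s) := by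
  have hi : Isometry (toLp s) := AddMonoidHomClass.isometry_of_norm _ fun _ => rfl
  rw [completeSpace_iff_isComplete_range hi.isUniformInducing]
  refine IsClosed.isComplete ?_
  have : Set.range (toLp s) = ⋂ k : ℤ,
      {a : lp (fun _ : ℤ => ℂ) 2 | (a : ℤ → ℂ) (-k) = starRingEnd ℂ ((a : ℤ → ℂ) k)} := by
    ext a
    simp only [Set.mem_range, Set.mem_iInter, Set.mem_ofPred_eq]
    constructor
    · rintro ⟨f, rfl⟩ k
      simp [toLp_apply, coeff_neg, sobolevWeight_neg]
    · intro ha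
      have hne : ∀ k, (sobolevWeight s k : ℂ) ≠ 0 :=
        fun k => by exact_mod_cast (sobolevWeight_pos s k).ne'
      obtain ⟨f, hf⟩ := exists_coeff hs (c := fun k => (sobolevWeight s k : ℂ)⁻¹ * (a : ℤ → ℂ) k)
        (fun k => by simp [ha k, sobolevWeight_neg]) (by
          have := (memℓp_gen_iff (p := 2) (by norm_num)).mp a.2
          simp only [ENNReal.toReal_ofNat, Real.rpow_two] at this
          refine this.congr fun k => ?_
          rw [norm_mul, norm_inv, Complex.norm_real, Real.norm_of_nonneg (sobolevWeight_pos s k).le,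
            mul_inv_cancel_left₀ (sobolevWeight_pos s k).ne'])
      refine ⟨f, Subtype.ext (funext fun k => ?_)⟩
      rw [toLp_apply, hf, mul_inv_cancel_left₀ (hne k)]
  rw [this]
  refine isClosed_iInter fun k => ?_
  have hev : ∀ j : ℤ, Continuous fun a : lp (fun _ : ℤ => ℂ) 2 => (a : ℤ → ℂ) j := fun j =>
    (continuous_apply j).comp (lp.uniformContinuous_coe (p := 2)).continuous
  exact isClosed_eq (hev _) (Complex.continuous_conj.comp (hev k))

/-- Fourier multipliers. -/
theorem exists_multiplier {s r : ℝ} (hr : 1 / 2 < r) {m : ℤ → ℂ}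
    (hm : ∀ k, m (-k) = starRingEnd ℂ (m k)) {C : ℝ} (hC : 0 ≤ C)
    (h : ∀ k, sobolevWeight r k * ‖m k‖ ≤ C * sobolevWeight s k) :
    ∃ M : Sobolev s →L[ℝ] Sobolev r, ∀ f k, (M f).coeff k = m k * f.coeff k := by
  have key : ∀ (f : Sobolev s) k, (sobolevWeight r k * ‖m k * f.coeff k‖) ^ 2
      ≤ C ^ 2 * (sobolevWeight s k * ‖f.coeff k‖) ^ 2 := fun f k => by
    rw [norm_mul, ← mul_assoc, ← mul_pow, ← mul_assoc]
    have := (sobolevWeight_pos r k).le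
    exact pow_le_pow_left₀ (by positivity) (mul_le_mul_of_nonneg_right (h k) (norm_nonneg _)) 2
  have hex : ∀ f : Sobolev s, ∃ g : Sobolev r, ∀ k, g.coeff k = m k * f.coeff k := fun f =>
    exists_coeff hr (fun k => by rw [hm, coeff_neg, map_mul])
      (Summable.of_nonneg_of_le (fun k => sq_nonneg _) (key f)
        ((hasSum_norm_sq f).summable.mul_left _))
  choose M hM using hex
  refine ⟨LinearMap.mkContinuous { toFun := M, map_add' := ?_, map_smul' := ?_ } C ?_, hM⟩
  · intro f g
    refine ext_coeff fun k => ?_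
    rw [coeff_add, hM, hM, hM, coeff_add, mul_add]
  · intro c f
    refine ext_coeff fun k => ?_
    rw [RingHom.id_apply, coeff_smul, hM, hM, coeff_smul]
    ring
  · intro f
    refine norm_le_of_hasSum (by positivity)
      (a := fun k => C ^ 2 * (sobolevWeight s k * ‖f.coeff k‖) ^ 2) ?_ (fun k => ?_)
    · rw [mul_pow]
      exact (hasSum_norm_sq f).mul_left _
    · simpa [hM] using key f k

end Sobolev

/-! ### The algebra structure of `H^s(S¹)` -/

/-- Peetre's inequality. -/
theorem sobolevWeight_sq_le {s : ℝ} (hs : 0 ≤ s) (j l : ℤ) :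
    sobolevWeight s (j + l) ^ 2 ≤ 4 ^ s * (sobolevWeight s j ^ 2 + sobolevWeight s l ^ 2) := by
  simp only [sobolevWeight_sq]
  push_cast
  have hm : (1 + ((j : ℝ) + l) ^ 2) ≤ 4 * max (1 + (j : ℝ) ^ 2) (1 + (l : ℝ) ^ 2) := by
    nlinarith [le_max_left (1 + (j : ℝ) ^ 2) (1 + (l : ℝ) ^ 2),
      le_max_right (1 + (j : ℝ) ^ 2) (1 + (l : ℝ) ^ 2), sq_nonneg ((j : ℝ) - l)]
  have hmax : max (1 + (j : ℝ) ^ 2) (1 + (l : ℝ) ^ 2) ^ s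
      ≤ (1 + (j : ℝ) ^ 2) ^ s + (1 + (l : ℝ) ^ 2) ^ s := by
    have h1 : 0 ≤ (1 + (j : ℝ) ^ 2) ^ s := by positivity
    have h2 : 0 ≤ (1 + (l : ℝ) ^ 2) ^ s := by positivity
    rcases max_choice (1 + (j : ℝ) ^ 2) (1 + (l : ℝ) ^ 2) with h | h <;> rw [h] <;> linarith
  calc (1 + ((j : ℝ) + l) ^ 2) ^ s ≤ (4 * max (1 + (j : ℝ) ^ 2) (1 + (l : ℝ) ^ 2)) ^ s :=
        Real.rpow_le_rpow (by positivity) hm hs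
    _ = 4 ^ s * max (1 + (j : ℝ) ^ 2) (1 + (l : ℝ) ^ 2) ^ s :=
        Real.mul_rpow (by norm_num) (by positivity)
    _ ≤ _ := by gcongr

/-- The square of the constant in the estimate `‖f g‖ ≤ C ‖f‖ ‖g‖`. -/
def mulConstSq (s : ℝ) : ℝ := 4 ^ s * (2 * ∑' k, (sobolevWeight s k ^ 2)⁻¹)

theorem mulConstSq_nonneg (s : ℝ) : 0 ≤ mulConstSq s := by
  have : 0 ≤ ∑' k, (sobolevWeight s k ^ 2)⁻¹ := tsum_nonneg fun k => by positivity
  unfold mulConstSq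
  positivity

/-- Peetre's inequality divided by the two weights leaves `w(j)⁻² + w(k - j)⁻²`, whose sum over `j`
does not depend on `k`. This uniformity in `k` is what makes `H^s` an algebra. -/
theorem summable_weight_quotient {s : ℝ} (hs : 1 / 2 < s) (k : ℤ) :
    (Summable fun j => (sobolevWeight s k / (sobolevWeight s j * sobolevWeight s (k - j))) ^ 2) ∧
      ∑' j, (sobolevWeight s k / (sobolevWeight s j * sobolevWeight s (k - j))) ^ 2
        ≤ mulConstSq s := by
  have h1 := summable_inv_sobolevWeight_sq hs
  have h2 : HasSum (fun j => (sobolevWeight s (k - j) ^ 2)⁻¹) (∑' k, (sobolevWeight s k ^ 2)⁻¹) :=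
    ((Equiv.subLeft k).hasSum_iff (f := fun j => (sobolevWeight s j ^ 2)⁻¹)).mpr h1.hasSum
  have h3 := (h1.hasSum.add h2).mul_left (4 ^ s)
  have hle : ∀ j, (sobolevWeight s k / (sobolevWeight s j * sobolevWeight s (k - j))) ^ 2
      ≤ 4 ^ s * ((sobolevWeight s j ^ 2)⁻¹ + (sobolevWeight s (k - j) ^ 2)⁻¹) := by
    intro j
    have a := sobolevWeight_pos s j
    have b := sobolevWeight_pos s (k - j)
    have h := sobolevWeight_sq_le (by linarith : 0 ≤ s) j (k - j)
    rw [add_sub_cancel] at h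
    rw [div_pow, div_le_iff₀ (by positivity)]
    have e : 4 ^ s * ((sobolevWeight s j ^ 2)⁻¹ + (sobolevWeight s (k - j) ^ 2)⁻¹) *
        (sobolevWeight s j * sobolevWeight s (k - j)) ^ 2
        = 4 ^ s * (sobolevWeight s j ^ 2 + sobolevWeight s (k - j) ^ 2) := by
      field_simp
      ring
    rw [e]
    exact h
  have h0 : ∀ j, 0 ≤ (sobolevWeight s k / (sobolevWeight s j * sobolevWeight s (k - j))) ^ 2 :=
    fun j => sq_nonneg _
  have hsum := Summable.of_nonneg_of_le h0 hle h3.summable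
  have hle' := hasSum_le hle hsum.hasSum h3
  rw [← two_mul] at hle'
  exact ⟨hsum, hle'⟩

namespace Sobolev

/-- The Fourier coefficients of a product are given by the convolution. -/
theorem hasSum_coeff_mul {s r : ℝ} (hs : 1 / 2 < s) (f : Sobolev s) (g : Sobolev r) (k : ℤ) :
    HasSum (fun j => f.coeff j * g.coeff (k - j)) (fourierCoeff (f.toCC * g.toCC) k) := by
  have h := ((hasSum_toCC hs f).mul_right g.toCC).mapL (fourierCoeffCLM k)
  rw [fourierCoeffCLM_apply] at h
  have e : ∀ j, fourierCoeffCLM k ((f.coeff j • fourier j : C(UnitAddCircle, ℂ)) * g.toCC)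
      = f.coeff j * g.coeff (k - j) := fun j => ?_
  · simpa only [e] using h
  rw [smul_mul_assoc, map_smul, smul_eq_mul, fourierCoeffCLM_apply]
  congr 1
  unfold coeff fourierCoeff
  congr 1
  ext x
  rw [neg_sub, sub_eq_add_neg, fourier_add]
  simp only [ContinuousMap.mul_apply, toCC_apply, smul_eq_mul]
  ring

/-- The double series of the products `A² B²`, resummed along the lines `j + l = k`. -/
theorem hasSum_convolution_sq {A B : ℤ → ℝ} {a b : ℝ}
    (hA : HasSum (fun k => A k ^ 2) a) (hB : HasSum (fun k => B k ^ 2) b) :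
    (∀ k, Summable fun j => (A j * B (k - j)) ^ 2) ∧
      HasSum (fun k => ∑' j, (A j * B (k - j)) ^ 2) (a * b) := by
  have hZ0 : HasSum (fun p : ℤ × ℤ => A p.1 ^ 2 * B p.2 ^ 2) (a * b) := by
    have h1 : (0 : ℤ → ℝ) ≤ fun k => A k ^ 2 := fun k => sq_nonneg (A k)
    have h2 : (0 : ℤ → ℝ) ≤ fun k => B k ^ 2 := fun k => sq_nonneg (B k)
    have h3 := hA.summable.mul_of_nonneg hB.summable h1 h2
    have h4 := hA.mul hB h3
    exact h4
  let e : ℤ × ℤ ≃ ℤ × ℤ :=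
    { toFun := fun p => (p.2, p.1 - p.2)
      invFun := fun p => (p.1 + p.2, p.1)
      left_inv := fun p => by ext <;> simp
      right_inv := fun p => by ext <;> simp }
  have hZ : HasSum (fun p : ℤ × ℤ => (A p.2 * B (p.1 - p.2)) ^ 2) (a * b) := by
    have h : (fun p : ℤ × ℤ => (A p.2 * B (p.1 - p.2)) ^ 2)
        = (fun p : ℤ × ℤ => A p.1 ^ 2 * B p.2 ^ 2) ∘ e := funext fun p => mul_pow _ _ _
    rw [h]
    exact e.hasSum_iff.mpr hZ0
  have hfib : ∀ k, Summable fun j => (A j * B (k - j)) ^ 2 := fun k => hZ.summable.prod_factor k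
  exact ⟨hfib, hZ.prod_fiberwise fun k => (hfib k).hasSum⟩

/-- Cauchy-Schwarz in `j` for the convolution, after each term is split into the quotient of weights
and the two weighted coefficients. -/
theorem norm_coeff_mul_le {s : ℝ} (hs : 1 / 2 < s) (f g : Sobolev s) (k : ℤ)
    (hfk : Summable fun j => ((sobolevWeight s j * ‖f.coeff j‖) *
      (sobolevWeight s (k - j) * ‖g.coeff (k - j)‖)) ^ 2) :
    (sobolevWeight s k * ‖fourierCoeff (f.toCC * g.toCC) k‖) ^ 2
      ≤ mulConstSq s * ∑' j, ((sobolevWeight s j * ‖f.coeff j‖) *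
        (sobolevWeight s (k - j) * ‖g.coeff (k - j)‖)) ^ 2 := by
  obtain ⟨hq, hq'⟩ := summable_weight_quotient hs k
  have hw := fun j => sobolevWeight_pos s j
  have n1 : ∀ j, 0 ≤ sobolevWeight s k / (sobolevWeight s j * sobolevWeight s (k - j)) :=
    fun j => (div_pos (hw k) (mul_pos (hw j) (hw (k - j)))).le
  have n2 : ∀ j, 0 ≤ (sobolevWeight s j * ‖f.coeff j‖) *
      (sobolevWeight s (k - j) * ‖g.coeff (k - j)‖) :=
    fun j => mul_nonneg (mul_nonneg (hw _).le (norm_nonneg _))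
      (mul_nonneg (hw _).le (norm_nonneg _))
  have hCS := Real.inner_le_Lp_mul_Lq_tsum_of_nonneg Real.HolderConjugate.two_two n1 n2
    (by simpa only [Real.rpow_two] using hq) (by simpa only [Real.rpow_two] using hfk)
  have hCSs := Real.summable_mul_of_Lp_Lq_of_nonneg Real.HolderConjugate.two_two n1 n2
    (by simpa only [Real.rpow_two] using hq) (by simpa only [Real.rpow_two] using hfk)
  simp only [Real.rpow_two, ← Real.sqrt_eq_rpow] at hCS
  have ht : ∀ j, sobolevWeight s k / (sobolevWeight s j * sobolevWeight s (k - j)) *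
      ((sobolevWeight s j * ‖f.coeff j‖) * (sobolevWeight s (k - j) * ‖g.coeff (k - j)‖))
      = sobolevWeight s k * ‖f.coeff j * g.coeff (k - j)‖ := fun j => by
    have := (hw j).ne'
    have := (hw (k - j)).ne'
    rw [norm_mul]
    field_simp
  rw [tsum_congr ht] at hCS
  have hCSs' := hCSs.congr ht
  have hle1 : sobolevWeight s k * ‖fourierCoeff (f.toCC * g.toCC) k‖
      ≤ ∑' j, sobolevWeight s k * ‖f.coeff j * g.coeff (k - j)‖ := by
    rw [tsum_mul_left]
    refine mul_le_mul_of_nonneg_left ?_ (hw k).le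
    rw [← (hasSum_coeff_mul hs f g k).tsum_eq]
    exact norm_tsum_le_tsum_norm ((summable_mul_left_iff (hw k).ne').mp hCSs')
  have n3 : 0 ≤ sobolevWeight s k * ‖fourierCoeff (f.toCC * g.toCC) k‖ :=
    mul_nonneg (hw k).le (norm_nonneg _)
  refine (pow_le_pow_left₀ n3 (hle1.trans hCS) 2).trans ?_
  rw [mul_pow, Real.sq_sqrt (tsum_nonneg fun _ => sq_nonneg _),
    Real.sq_sqrt (tsum_nonneg fun _ => sq_nonneg _)]
  exact mul_le_mul_of_nonneg_right hq' (tsum_nonneg fun _ => sq_nonneg _)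

theorem exists_mul {s : ℝ} (hs : 1 / 2 < s) (f g : Sobolev s) :
    ∃ h : Sobolev s, (∀ x, h x = f x * g x) ∧ ‖h‖ ≤ √(mulConstSq s) * ‖f‖ * ‖g‖ := by
  obtain ⟨hfib, hS⟩ := hasSum_convolution_sq (hasSum_norm_sq f) (hasSum_norm_sq g)
  have hle := fun k => norm_coeff_mul_le hs f g k (hfib k)
  have hS' := hS.mul_left (mulConstSq s)
  have hmem : f.toC * g.toC ∈ sobolevSubmodule s := by
    refine (memℓp_gen_iff (by norm_num)).mpr ?_
    simp only [ENNReal.toReal_ofNat, Real.rpow_two]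
    refine (Summable.of_nonneg_of_le (fun k => sq_nonneg _) hle hS'.summable).congr fun k => ?_
    change _ = ‖(sobolevWeight s k : ℂ) *
      fourierCoeff (fun x => (((f.toC x * g.toC x : ℝ)) : ℂ)) k‖ ^ 2
    rw [norm_mul, Complex.norm_real, Real.norm_of_nonneg (sobolevWeight_pos s k).le]
    congr 4
    ext x
    simp
  have hv : ∀ x, Sobolev.toC (⟨f.toC * g.toC, hmem⟩ : Sobolev s) x = f x * g x := fun x => rfl
  refine ⟨⟨f.toC * g.toC, hmem⟩, hv, ?_⟩
  refine norm_le_of_hasSum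
    (a := fun k => mulConstSq s * ∑' j, ((sobolevWeight s j * ‖f.coeff j‖) *
        (sobolevWeight s (k - j) * ‖g.coeff (k - j)‖)) ^ 2) (by positivity) ?_ fun k => ?_
  · rw [mul_pow, mul_pow, Real.sq_sqrt (mulConstSq_nonneg s), mul_assoc]
    exact hS'
  · refine le_of_eq_of_le ?_ (hle k)
    congr 3
    change fourierCoeff (fun x => (((f.toC x * g.toC x : ℝ)) : ℂ)) k = _
    congr 1
    ext x
    simp

theorem exists_mulCLM {s : ℝ} (hs : 1 / 2 < s) :
    ∃ M : Sobolev s →L[ℝ] Sobolev s →L[ℝ] Sobolev s, ∀ f g x, M f g x = f x * g x := by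
  choose m hm hm' using exists_mul hs
  let B : Sobolev s →ₗ[ℝ] Sobolev s →ₗ[ℝ] Sobolev s := LinearMap.mk₂ ℝ m
    (fun f f' g => ext_apply fun x => by rw [add_apply, hm, hm, hm, add_apply, add_mul])
    (fun c f g => ext_apply fun x => by rw [smul_apply, hm, hm, smul_apply, mul_assoc])
    (fun f g g' => ext_apply fun x => by rw [add_apply, hm, hm, hm, add_apply, mul_add])
    (fun c f g => ext_apply fun x => by rw [smul_apply, hm, hm, smul_apply, mul_left_comm])
  exact ⟨B.mkContinuous₂ (√(mulConstSq s)) hm', hm⟩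

/-- The product of `H^s(S¹)`, for `s > 1/2`, as a continuous bilinear map. -/
def mulCLM {s : ℝ} (hs : 1 / 2 < s) : Sobolev s →L[ℝ] Sobolev s →L[ℝ] Sobolev s :=
  (exists_mulCLM hs).choose

@[simp] theorem mulCLM_apply {s : ℝ} (hs : 1 / 2 < s) (f g : Sobolev s) (x : UnitAddCircle) :
    mulCLM hs f g x = f x * g x := (exists_mulCLM hs).choose_spec f g x

theorem mulCLM_pow_apply {s : ℝ} (hs : 1 / 2 < s) (f g : Sobolev s) (n : ℕ) (x : UnitAddCircle) :
    (mulCLM hs f ^ n) g x = f x ^ n * g x := by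
  induction n with
  | zero => simp
  | succ n ih => rw [pow_succ', mul_apply_eq_comp, mulCLM_apply, ih, pow_succ']; ring

end Sobolev

/-! ### Logarithms of positive Sobolev functions -/

namespace Sobolev

theorem coeff_mulCLM {s : ℝ} (hs : 1 / 2 < s) (f g : Sobolev s) (k : ℤ) :
    HasSum (fun j => f.coeff j * g.coeff (k - j)) ((mulCLM hs f g).coeff k) := by
  have h := hasSum_coeff_mul hs f g k
  have e : (mulCLM hs f g).toCC = f.toCC * g.toCC := by
    ext x
    simp
  rwa [← fourierCoeff_toCC, e]

theorem coeff_one_of_ne {s : ℝ} {k : ℤ} (hk : k ≠ 0) : (Sobolev.one s).coeff k = 0 := by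
  have h1 := congrFun (fourierCoeff_fourier (T := 1) 0) k
  have h2 : (fun x : UnitAddCircle => ((Sobolev.one s x : ℝ) : ℂ))
      = (fourier 0 : C(UnitAddCircle, ℂ)) := by
    ext x; simp
  rw [coeff, h2, h1, Pi.single_eq_of_ne hk]

/-- Truncation of the Fourier series: the error is bounded by a tail of the convergent series for
`‖f‖²`. -/
theorem exists_bandlimited {s : ℝ} (hs : 1 / 2 < s) (f : Sobolev s) {ε : ℝ} (hε : 0 < ε) :
    ∃ (N : ℕ) (P : Sobolev s), ‖f - P‖ < ε ∧ ∀ k : ℤ, N < k.natAbs → P.coeff k = 0 := by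
  have hf := hasSum_norm_sq f
  obtain ⟨F, hF⟩ := ((tendsto_order.mp (tendsto_tsum_compl_atTop_zero
    fun k => (sobolevWeight s k * ‖f.coeff k‖) ^ 2)).2 (ε ^ 2) (by positivity)).exists
  let N : ℕ := F.sup Int.natAbs
  obtain ⟨T, hT⟩ := exists_multiplier (s := s) hs (m := fun k => if k.natAbs ≤ N then 1 else 0)
    (fun k => by simp only [Int.natAbs_neg]; split_ifs <;> simp) zero_le_one
    (fun k => by
      rw [one_mul]
      split_ifs
      · simp
      · simpa using (sobolevWeight_pos s k).le)
  refine ⟨N, T f, ?_, fun k hk => by rw [hT, if_neg (by omega), zero_mul]⟩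
  refine (sq_lt_sq₀ (norm_nonneg _) hε.le).mp (lt_of_le_of_lt ?_ hF)
  have h1 : Summable fun k : { k // k ∉ F } => (sobolevWeight s k * ‖f.coeff k‖) ^ 2 :=
    hf.summable.subtype _
  have h2 : HasSum (({k | k ∉ F} : Set ℤ).indicator
      fun k => (sobolevWeight s k * ‖f.coeff k‖) ^ 2)
      (∑' k : { k // k ∉ F }, (sobolevWeight s k * ‖f.coeff k‖) ^ 2) :=
    hasSum_subtype_iff_indicator.mp h1.hasSum
  refine hasSum_le (fun k => ?_) (hasSum_norm_sq (f - T f)) h2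
  rw [coeff_sub, hT]
  by_cases hk : k ∈ F
  · have : k.natAbs ≤ N := Finset.le_sup (f := Int.natAbs) hk
    rw [if_pos this, Set.indicator_of_notMem (by simpa using hk)]
    simp
  · rw [Set.indicator_of_mem (by simpa using hk)]
    have := (sobolevWeight_pos s k).le
    split_ifs
    · rw [one_mul, sub_self, norm_zero, mul_zero, zero_pow two_ne_zero]
      exact sq_nonneg _
    · simp

/-- Degrees of trigonometric polynomials add under multiplication. -/
theorem coeff_pow_eq_zero {s : ℝ} (hs : 1 / 2 < s) {P : Sobolev s} {N : ℕ}
    (hP : ∀ k : ℤ, N < k.natAbs → P.coeff k = 0) (n : ℕ) :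
    ∀ k : ℤ, n * N < k.natAbs → ((mulCLM hs P ^ n) (one s)).coeff k = 0 := by
  induction n with
  | zero =>
    intro k hk
    rw [pow_zero, one_apply_eq_self]
    exact coeff_one_of_ne (by rintro rfl; simp at hk)
  | succ n ih =>
    intro k hk
    rw [pow_succ', mul_apply_eq_comp]
    refine (coeff_mulCLM hs P _ k).unique ?_
    have : ∀ j, P.coeff j * ((mulCLM hs P ^ n) (one s)).coeff (k - j) = 0 := by
      intro j
      by_cases hj : N < j.natAbs
      · rw [hP j hj, zero_mul]
      · rw [ih (k - j), mul_zero]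
        have : (n + 1) * N = n * N + N := by ring
        omega
    simp only [this]
    exact hasSum_zero

/-- Parseval, read off from the zeroth coefficient of `f²`: for real `f`, `f̂(j) f̂(-j) = |f̂(j)|²`.
-/
theorem hasSum_coeff_sq {s : ℝ} (hs : 1 / 2 < s) (f : Sobolev s) {B : ℝ} (hB : ∀ x, |f x| ≤ B) :
    ∃ b ≤ B ^ 2, HasSum (fun k => ‖f.coeff k‖ ^ 2) b := by
  have h := hasSum_coeff_mul hs f f 0
  have e : ∀ j, f.coeff j * f.coeff (0 - j) = ((‖f.coeff j‖ ^ 2 : ℝ) : ℂ) := fun j => by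
    rw [zero_sub, coeff_neg, Complex.mul_conj, Complex.normSq_eq_norm_sq]
  simp only [e] at h
  have h' := Complex.hasSum_re h
  simp only [Complex.ofReal_re] at h'
  refine ⟨_, ?_, h'⟩
  refine (Complex.re_le_norm _).trans ((norm_fourierCoeff_le _ 0).trans ?_)
  refine (ContinuousMap.norm_le _ (sq_nonneg B)).mpr fun x => ?_
  rw [ContinuousMap.mul_apply, norm_mul, toCC_apply, Complex.norm_real, Real.norm_eq_abs, ← sq]
  exact pow_le_pow_left₀ (abs_nonneg _) (hB x) 2

/-- For band-limited functions the Sobolev norm is controlled by the supremum. -/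
theorem norm_le_of_bandlimited {s : ℝ} (hs : 1 / 2 < s) {f : Sobolev s} {B : ℝ} (hB0 : 0 ≤ B)
    (hB : ∀ x, |f x| ≤ B) {N : ℕ} (hf : ∀ k : ℤ, N < k.natAbs → f.coeff k = 0) :
    ‖f‖ ≤ sobolevWeight s N * B := by
  obtain ⟨b, hb, hsum⟩ := hasSum_coeff_sq hs f hB
  have h := hsum.mul_left (sobolevWeight s N ^ 2)
  refine (sq_le_sq₀ (norm_nonneg _) (mul_nonneg (sobolevWeight_pos s N).le hB0)).mp ?_
  rw [mul_pow]
  refine (hasSum_le (fun k => ?_) (hasSum_norm_sq f) h).trans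
    (mul_le_mul_of_nonneg_left hb (sq_nonneg _))
  by_cases hk : N < k.natAbs
  · simp [hf k hk]
  · rw [mul_pow]
    refine mul_le_mul_of_nonneg_right ?_ (sq_nonneg _)
    rw [sobolevWeight_sq, sobolevWeight_sq]
    have h1 : |(k : ℝ)| ≤ N := by
      have := not_lt.mp hk
      rw [← Int.cast_abs, Int.abs_eq_natAbs]
      exact_mod_cast this
    have h2 : (k : ℝ) ^ 2 ≤ ((N : ℤ) : ℝ) ^ 2 := by
      push_cast
      exact sq_le_sq' (by linarith [neg_abs_le (k : ℝ)]) (by linarith [le_abs_self (k : ℝ)])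
    exact Real.rpow_le_rpow (by positivity) (by linarith) (by linarith)

theorem commute_mulCLM {s : ℝ} (hs : 1 / 2 < s) (f g : Sobolev s) :
    Commute (mulCLM hs f) (mulCLM hs g) := by
  refine ContinuousLinearMap.ext fun u => ext_apply fun x => ?_
  simp only [mul_apply_eq_comp, mulCLM_apply]
  ring

theorem norm_mulCLM_pow_apply_le {s : ℝ} (hs : 1 / 2 < s) (f u : Sobolev s) (n : ℕ) :
    ‖(mulCLM hs f ^ n) u‖ ≤ ‖mulCLM hs f‖ ^ n * ‖u‖ := by
  induction n with
  | zero => simp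
  | succ n ih =>
    rw [pow_succ', mul_apply_eq_comp, pow_succ', mul_assoc]
    exact (ContinuousLinearMap.le_opNorm _ _).trans
      (mul_le_mul_of_nonneg_left ih (norm_nonneg _))

/-- Binomial expansion of `(e + P)^n`. Powers of the small part `e` cost only an operator norm.
Powers of the trigonometric polynomial `P` have degree at most `n N`, so their Sobolev norm costs a
supremum bound and one common weight. -/
theorem norm_mulCLM_pow_one_le {s : ℝ} (hs : 1 / 2 < s) {P e : Sobolev s} {N : ℕ}
    (hP : ∀ k : ℤ, N < k.natAbs → P.coeff k = 0) {B : ℝ} (hB0 : 0 ≤ B) (hB : ∀ x, |P x| ≤ B)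
    (n : ℕ) : ‖(mulCLM hs (e + P) ^ n) (one s)‖
      ≤ sobolevWeight s (n * N : ℕ) * (‖mulCLM hs e‖ + B) ^ n := by
  have hpow : ∀ m ≤ n, ‖(mulCLM hs P ^ m) (one s)‖ ≤ sobolevWeight s (n * N : ℕ) * B ^ m := by
    intro m hm
    refine norm_le_of_bandlimited hs (by positivity) (fun x => ?_) (fun k hk => ?_)
    · rw [mulCLM_pow_apply, one_apply, mul_one, abs_pow]
      exact pow_le_pow_left₀ (abs_nonneg _) (hB x) m
    · exact coeff_pow_eq_zero hs hP m k (lt_of_le_of_lt (Nat.mul_le_mul_right N hm) hk)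
  rw [map_add, (commute_mulCLM hs e P).add_pow, add_pow, Finset.mul_sum,
    sum_apply]
  refine norm_sum_le_of_le _ fun m hm => ?_
  have hm' : m ≤ n := by simpa [Nat.lt_succ_iff] using hm
  have e1 : (mulCLM hs e ^ m * mulCLM hs P ^ (n - m) * ((n.choose m : ℕ) :
      Sobolev s →L[ℝ] Sobolev s)) (one s)
      = (n.choose m : ℝ) • (mulCLM hs e ^ m) ((mulCLM hs P ^ (n - m)) (one s)) := by
    rw [mul_apply_eq_comp, mul_apply_eq_comp, ← nsmul_one, _root_.smul_apply, one_apply_eq_self,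
      map_nsmul, map_nsmul, Nat.cast_smul_eq_nsmul]
  rw [e1, norm_smul, Real.norm_natCast]
  have h1 : ‖(mulCLM hs e ^ m) ((mulCLM hs P ^ (n - m)) (one s))‖
      ≤ ‖mulCLM hs e‖ ^ m * (sobolevWeight s (n * N : ℕ) * B ^ (n - m)) := by
    exact (norm_mulCLM_pow_apply_le hs e _ m).trans
      (mul_le_mul_of_nonneg_left (hpow _ (Nat.sub_le n m)) (by positivity))
  calc _ ≤ _ := mul_le_mul_of_nonneg_left h1 (Nat.cast_nonneg _)
    _ = _ := by ring

/-- The spectral radius of `h` in `H^s(S¹)` is at most its supremum norm. -/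
theorem summable_norm_pow {s : ℝ} (hs : 1 / 2 < s) {h : Sobolev s} {ρ : ℝ} (hρ0 : 0 ≤ ρ)
    (hρ : ρ < 1) (hh : ∀ x, |h x| ≤ ρ) :
    Summable fun n : ℕ => ‖(mulCLM hs h ^ (n + 1)) (one s)‖ := by
  set C := ‖mulCLM hs‖ + embConst s with hC
  have hC0 : 0 ≤ C := add_nonneg (norm_nonneg (mulCLM hs)) (embConst_nonneg s)
  -- The ratio `θ` below is at most `ρ + C ‖h - P‖`, so this `ε` makes it less than 1; the `+ 1`
  -- avoids a zero denominator.
  obtain ⟨N, P, hP, hN⟩ := exists_bandlimited hs h (ε := (1 - ρ) / (C + 1))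
    (div_pos (by linarith) (by linarith))
  rw [lt_div_iff₀ (by linarith)] at hP
  have hB : ∀ x, |P x| ≤ ρ + embConst s * ‖h - P‖ := fun x => by
    have h1 := abs_apply_le hs (h - P) x
    have h2 := hh x
    rw [sub_apply, abs_le] at h1
    rw [abs_le] at h2 ⊢
    constructor <;> linarith [h1.1, h1.2, h2.1, h2.2]
  have hB0 : 0 ≤ ρ + embConst s * ‖h - P‖ :=
    add_nonneg hρ0 (mul_nonneg (embConst_nonneg s) (norm_nonneg _))
  set θ := ‖mulCLM hs (h - P)‖ + (ρ + embConst s * ‖h - P‖) with hθ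
  have hθ0 : 0 ≤ θ := add_nonneg (norm_nonneg _) hB0
  have hθ1 : θ < 1 := by
    have h1 := (mulCLM hs).le_opNorm (h - P)
    have h2 : 0 ≤ ‖h - P‖ := norm_nonneg _
    have h3 : ‖mulCLM hs‖ * ‖h - P‖ + embConst s * ‖h - P‖ = ‖h - P‖ * C := by rw [hC]; ring
    nlinarith
  -- The weight at degree `(n + 1) N` grows only polynomially in `n`, so the geometric factor `θ^(n
  -- + 1)` wins. A natural exponent `d` suffices as a bound.
  obtain ⟨d, hd⟩ := exists_nat_ge (s / 2)
  have hw : ∀ n : ℕ, sobolevWeight s (((n + 1) * N : ℕ) : ℤ)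
      ≤ (1 + (N : ℝ) ^ 2) ^ d * ((n + 1 : ℕ) : ℝ) ^ (2 * d) := by
    intro n
    unfold sobolevWeight
    have h1 : (1 : ℝ) ≤ 1 + ((((n + 1) * N : ℕ) : ℤ) : ℝ) ^ 2 := by nlinarith
    refine (Real.rpow_le_rpow_of_exponent_le h1 hd).trans ?_
    rw [Real.rpow_natCast, pow_mul, ← mul_pow]
    refine pow_le_pow_left₀ (by positivity) ?_ d
    push_cast
    nlinarith [sq_nonneg (n : ℝ), (Nat.cast_nonneg n : (0 : ℝ) ≤ n)]
  have hs1 := (summable_nat_add_iff 1).mpr (summable_pow_mul_geometric_of_norm_lt_one (2 * d)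
    (r := θ) (by rwa [Real.norm_of_nonneg hθ0]))
  refine Summable.of_nonneg_of_le (fun n => norm_nonneg _) (fun n => ?_)
    (hs1.mul_left ((1 + (N : ℝ) ^ 2) ^ d))
  have h1 := norm_mulCLM_pow_one_le hs (e := h - P) hN hB0 hB (n + 1)
  rw [sub_add_cancel] at h1
  refine h1.trans ?_
  rw [← mul_assoc]
  exact mul_le_mul_of_nonneg_right (hw n) (by positivity)

/-- With `M = max f` and `h = 1 - f / M`, compactness gives `0 ≤ h ≤ 1 - min f / M < 1`. Then `log f
= log M - ∑ h^(n+1) / (n+1)` converges in `H^s` although the Sobolev norm of `h` may be large, since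
only its supremum norm matters for the growth of powers. -/
theorem exists_log {s : ℝ} (hs : 1 / 2 < s) {f : Sobolev s} (hf : ∀ x, 0 < f x) :
    ∃ l : Sobolev s, ∀ x, l x = Real.log (f x) := by
  have := completeSpace hs
  obtain ⟨x₀, -, hmin⟩ := isCompact_univ.exists_isMinOn Set.univ_nonempty
    f.toC.continuous.continuousOn
  obtain ⟨x₁, -, hmax⟩ := isCompact_univ.exists_isMaxOn Set.univ_nonempty
    f.toC.continuous.continuousOn
  set M := f x₁ with hM
  set m := f x₀ with hm
  have hm0 : 0 < m := hf x₀
  have hM0 : 0 < M := hf x₁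
  have hle : ∀ x, m ≤ f x ∧ f x ≤ M := fun x => ⟨hmin (Set.mem_univ x), hmax (Set.mem_univ x)⟩
  let h : Sobolev s := one s - M⁻¹ • f
  have hhx : ∀ x, h x = 1 - M⁻¹ * f x := fun x => rfl
  have hρ : 1 - m / M < 1 := by linarith [div_pos hm0 hM0]
  have hρ0 : 0 ≤ 1 - m / M := by
    rw [sub_nonneg, div_le_one hM0]
    exact (hle x₁).1
  have hh : ∀ x, |h x| ≤ 1 - m / M := fun x => by
    have h1 : m / M ≤ M⁻¹ * f x := by
      rw [div_eq_inv_mul]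
      exact mul_le_mul_of_nonneg_left (hle x).1 (by positivity)
    have h2 : M⁻¹ * f x ≤ 1 := by
      rw [← div_eq_inv_mul, div_le_one hM0]
      exact (hle x).2
    rw [hhx, abs_of_nonneg (by linarith)]
    linarith
  have hsum : Summable fun n : ℕ => ((n : ℝ) + 1)⁻¹ • (mulCLM hs h ^ (n + 1)) (one s) := by
    refine Summable.of_norm_bounded (summable_norm_pow hs hρ0 hρ hh) fun n => ?_
    rw [norm_smul]
    refine mul_le_of_le_one_left (norm_nonneg _) ?_
    rw [Real.norm_of_nonneg (by positivity)]
    exact inv_le_one_of_one_le₀ (by linarith [(Nat.cast_nonneg n : (0 : ℝ) ≤ n)])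
  obtain ⟨S, hS⟩ := hsum
  refine ⟨Real.log M • one s - S, fun x => ?_⟩
  have h1 := hS.mapL (ev hs x)
  have h2 := Real.hasSum_pow_div_log_of_abs_lt_one (lt_of_le_of_lt (hh x) hρ)
  have h3 : S x = -Real.log (1 - h x) := by
    refine h1.unique ?_
    convert h2 using 2 with n
    rw [map_smul, ev_apply, mulCLM_pow_apply, one_apply, smul_eq_mul, mul_one, div_eq_inv_mul]
  rw [sub_apply, h3, smul_apply, one_apply, hhx, sub_sub_cancel,
    Real.log_mul (by positivity) (hf x).ne', Real.log_inv]
  ring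

end Sobolev

/-! ### Smoothness of the exponential and the logarithm -/

namespace Sobolev

theorem continuous_toC {s : ℝ} (hs : 1 / 2 < s) :
    Continuous (toC : Sobolev s → C(UnitAddCircle, ℝ)) := by
  let T : Sobolev s →ₗ[ℝ] C(UnitAddCircle, ℝ) :=
    { toFun := toC, map_add' := fun _ _ => rfl, map_smul' := fun _ _ => rfl }
  exact (T.mkContinuous (embConst s) fun f => (ContinuousMap.norm_le _
    (mul_nonneg (embConst_nonneg s) (norm_nonneg f))).mpr fun x => abs_apply_le hs f x).continuous

theorem isOpen_pos {s : ℝ} (hs : 1 / 2 < s) : IsOpen {f : Sobolev s | ∀ x, 0 < f x} := by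
  have h := (ContinuousMap.isOpen_setOfPred_mapsTo (X := UnitAddCircle) isCompact_univ
    (isOpen_Ioi (a := (0 : ℝ)))).preimage (continuous_toC hs)
  convert h using 1
  ext f
  simp [Set.MapsTo]

/-- The exponential of `H^s(S¹)`. -/
def expS {s : ℝ} (hs : 1 / 2 < s) (f : Sobolev s) : Sobolev s :=
  NormedSpace.exp (mulCLM hs f) (one s)

theorem expS_apply {s : ℝ} (hs : 1 / 2 < s) (f : Sobolev s) (x : UnitAddCircle) :
    expS hs f x = Real.exp (f x) := by
  have := completeSpace hs
  have h1 := NormedSpace.exp_series_hasSum_exp' (𝕂 := ℝ) (mulCLM hs f)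
  have h2 := (h1.mapL (ContinuousLinearMap.apply ℝ (Sobolev s) (one s))).mapL (ev hs x)
  have h3 := NormedSpace.exp_series_hasSum_exp' (𝕂 := ℝ) (f x)
  rw [← Real.exp_eq_exp_ℝ] at h3
  refine h2.unique ?_
  refine (congrArg (fun F : ℕ → ℝ => HasSum F (Real.exp (f x))) (funext fun n => ?_)).mpr h3
  rw [ContinuousLinearMap.apply_apply, _root_.smul_apply, map_smul, ev_apply, mulCLM_pow_apply,
    one_apply, mul_one]

theorem contDiff_expS {s : ℝ} (hs : 1 / 2 < s) : ContDiff ℝ ∞ (expS hs) := by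
  have := completeSpace hs
  have h1 : ContDiff ℝ ∞ (NormedSpace.exp : (Sobolev s →L[ℝ] Sobolev s) → _) :=
    contDiff_iff_contDiffAt.mpr fun x => (NormedSpace.exp_analytic (𝕂 := ℝ) x).contDiffAt
  exact (ContinuousLinearMap.apply ℝ (Sobolev s) (one s)).contDiff.comp
    (h1.comp (mulCLM hs).contDiff)

/-- Differentiability is already known and point evaluations separate functions, so the scalar chain
rule at each point identifies the derivative. -/
theorem hasFDerivAt_expS {s : ℝ} (hs : 1 / 2 < s) (f : Sobolev s) :
    HasFDerivAt (expS hs) (mulCLM hs (expS hs f)) f := by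
  have h := ((contDiff_expS hs).differentiable (by simp) f).hasFDerivAt
  suffices e : mulCLM hs (expS hs f) = fderiv ℝ (expS hs) f by rwa [e]
  refine ContinuousLinearMap.ext fun u => ext_apply fun x => ?_
  have h1 : HasFDerivAt (fun g => expS hs g x) ((ev hs x).comp (fderiv ℝ (expS hs) f)) f :=
    (ev hs x).hasFDerivAt.comp f h
  have h2 : HasFDerivAt (fun g : Sobolev s => Real.exp (g x)) (Real.exp (f x) • ev hs x) f :=
    (ev hs x).hasFDerivAt.exp
  simp only [expS_apply] at h1
  have h3 := congrArg (fun T => T u) (h2.unique h1)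
  rw [mulCLM_apply, expS_apply]
  exact h3

open scoped Classical in
/-- The logarithm of the positive functions of class `H^s`. -/
def logS {s : ℝ} (hs : 1 / 2 < s) (f : Sobolev s) : Sobolev s :=
  if h : ∀ x, 0 < f x then (exists_log hs h).choose else 0

theorem logS_apply {s : ℝ} (hs : 1 / 2 < s) {f : Sobolev s} (hf : ∀ x, 0 < f x)
    (x : UnitAddCircle) : logS hs f x = Real.log (f x) := by
  rw [logS, dif_pos hf]
  exact (exists_log hs hf).choose_spec x

theorem logS_expS {s : ℝ} (hs : 1 / 2 < s) (f : Sobolev s) : logS hs (expS hs f) = f :=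
  ext_apply fun x => by
    rw [logS_apply hs (fun x => by rw [expS_apply]; exact Real.exp_pos _), expS_apply, Real.log_exp]

theorem expS_logS {s : ℝ} (hs : 1 / 2 < s) {f : Sobolev s} (hf : ∀ x, 0 < f x) :
    expS hs (logS hs f) = f :=
  ext_apply fun x => by rw [expS_apply, logS_apply hs hf, Real.exp_log (hf x)]

/-- Inverse function theorem: the derivative of the exponential at `l` is multiplication by `exp l`,
with inverse multiplication by `exp (-l)`, and the local inverse must agree with `logS`. -/
theorem contDiffAt_logS_expS {s : ℝ} (hs : 1 / 2 < s) (l : Sobolev s) :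
    ContDiffAt ℝ ∞ (logS hs) (expS hs l) := by
  have := completeSpace hs
  have hinv : ∀ (a u : Sobolev s), mulCLM hs (expS hs (-a)) (mulCLM hs (expS hs a) u) = u := by
    intro a u
    refine ext_apply fun x => ?_
    rw [mulCLM_apply, mulCLM_apply, expS_apply, expS_apply, neg_apply, ← mul_assoc, ← Real.exp_add,
      neg_add_cancel, Real.exp_zero, one_mul]
  let D : Sobolev s ≃L[ℝ] Sobolev s := ContinuousLinearEquiv.equivOfInverse
    (mulCLM hs (expS hs l)) (mulCLM hs (expS hs (-l))) (hinv l)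
    (fun u => by simpa using hinv (-l) u)
  have hD : HasFDerivAt (expS hs) (D : Sobolev s →L[ℝ] Sobolev s) l := hasFDerivAt_expS hs l
  have hc : ContDiffAt ℝ ∞ (expS hs) l := (contDiff_expS hs).contDiffAt
  have h1 := hc.to_localInverse hD (by simp)
  have h2 := (hc.hasStrictFDerivAt' hD (by simp)).eventually_right_inverse
  refine h1.congr_of_eventuallyEq (h2.mono fun g hg => ?_)
  conv_lhs => rw [← hg]
  exact logS_expS hs _

theorem contDiffAt_logS {s : ℝ} (hs : 1 / 2 < s) {f : Sobolev s} (hf : ∀ x, 0 < f x) :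
    ContDiffAt ℝ ∞ (logS hs) f := by
  rw [← expS_logS hs hf]
  exact contDiffAt_logS_expS hs _

end Sobolev

/-! ### Derivatives and primitives -/

instance : IsProbabilityMeasure (volume : Measure UnitAddCircle) := ⟨by simp⟩

theorem volume_eq_haarAddCircle :
    (volume : Measure UnitAddCircle) = AddCircle.haarAddCircle := by
  rw [AddCircle.volume_eq_smul_haarAddCircle, ENNReal.ofReal_one, one_smul]

theorem sobolevWeight_eq_mul (s : ℝ) (k : ℤ) :
    sobolevWeight s k = sobolevWeight (s - 1) k * √(1 + (k : ℝ) ^ 2) := by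
  unfold sobolevWeight
  rw [Real.sqrt_eq_rpow, ← Real.rpow_add (by positivity)]
  congr 1
  ring

namespace Sobolev

theorem integrable {s : ℝ} (f : Sobolev s) : Integrable (fun x => f x) :=
  f.toC.continuous.integrable_of_hasCompactSupport (HasCompactSupport.of_compactSpace _)

theorem coeff_zero {s : ℝ} (f : Sobolev s) : f.coeff 0 = ((∫ x, f x : ℝ) : ℂ) := by
  unfold coeff fourierCoeff
  rw [← integral_complex_ofReal, volume_eq_haarAddCircle]
  simp

theorem coeff_one_zero (s : ℝ) : (one s).coeff 0 = 1 := by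
  rw [coeff_zero]
  simp

theorem exists_deriv {s : ℝ} (hs : 3 / 2 < s) : ∃ D : Sobolev s →L[ℝ] Sobolev (s - 1),
    ∀ f k, (D f).coeff k = 2 * Real.pi * Complex.I * k * f.coeff k := by
  refine exists_multiplier (by linarith) (fun k => by simp [Complex.conj_ofNat]) (C := 2 * Real.pi)
    (by positivity) fun k => ?_
  have h : |(k : ℝ)| ≤ √(1 + (k : ℝ) ^ 2) := Real.abs_le_sqrt (by linarith)
  have e : ‖2 * (Real.pi : ℂ) * Complex.I * k‖ = 2 * Real.pi * |(k : ℝ)| := by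
    rw [← Complex.ofReal_intCast, norm_mul, norm_mul, norm_mul, Complex.norm_I, Complex.norm_real,
      Complex.norm_real, Real.norm_of_nonneg Real.pi_pos.le]
    simp
  rw [e, sobolevWeight_eq_mul s]
  have := (sobolevWeight_pos (s - 1) k).le
  calc _ = 2 * Real.pi * sobolevWeight (s - 1) k * |(k : ℝ)| := by ring
    _ ≤ 2 * Real.pi * sobolevWeight (s - 1) k * √(1 + (k : ℝ) ^ 2) := by gcongr
    _ = _ := by ring

/-- The derivative `H^s → H^{s-1}`. -/
def derivCLM {s : ℝ} (hs : 3 / 2 < s) : Sobolev s →L[ℝ] Sobolev (s - 1) := (exists_deriv hs).choose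

theorem coeff_derivCLM {s : ℝ} (hs : 3 / 2 < s) (f : Sobolev s) (k : ℤ) :
    (derivCLM hs f).coeff k = 2 * Real.pi * Complex.I * k * f.coeff k :=
  (exists_deriv hs).choose_spec f k

/-- Termwise differentiation of the Fourier series, dominated by the coefficients of `derivCLM hs
f`, which are absolutely summable because `s - 1 > 1/2`. -/
theorem hasDerivAt_coe {s : ℝ} (hs : 3 / 2 < s) (f : Sobolev s) (t : ℝ) :
    HasDerivAt (fun t : ℝ => f (t : UnitAddCircle)) (derivCLM hs f (t : UnitAddCircle)) t := by
  have hs' : 1 / 2 < s - 1 := by linarith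
  have h1 : HasDerivAt (fun z : ℝ => ∑' k, f.coeff k * fourier k (z : UnitAddCircle))
      (∑' k, f.coeff k * (2 * Real.pi * Complex.I * k / (1 : ℝ) * fourier k (t : UnitAddCircle)))
      t := by
    refine hasDerivAt_tsum (summable_coeff hs' (derivCLM hs f))
      (fun k z => (hasDerivAt_fourier 1 k z).const_mul _) (fun k z => ?_)
      (y₀ := 0) (hasSum_apply (by linarith) f ((0 : ℝ) : UnitAddCircle)).summable t
    rw [coeff_derivCLM, fourier_apply, Complex.ofReal_one, div_one, norm_mul, norm_mul,
      Circle.norm_coe, mul_one, norm_mul _ (f.coeff k), mul_comm]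
  have e1 : (fun z : ℝ => ∑' k, f.coeff k * fourier k (z : UnitAddCircle))
      = fun z : ℝ => ((f (z : UnitAddCircle) : ℝ) : ℂ) :=
    funext fun z => (hasSum_apply (by linarith) f _).tsum_eq
  have e2 : (∑' k, f.coeff k * (2 * Real.pi * Complex.I * k / (1 : ℝ) *
      fourier k (t : UnitAddCircle))) = ((derivCLM hs f (t : UnitAddCircle) : ℝ) : ℂ) := by
    rw [← (hasSum_apply hs' (derivCLM hs f) _).tsum_eq]
    refine tsum_congr fun k => ?_
    rw [coeff_derivCLM, Complex.ofReal_one, div_one]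
    ring
  rw [e1, e2] at h1
  exact (Complex.reCLM.hasFDerivAt.comp_hasDerivAt t h1)

theorem circleDeriv_eq {s : ℝ} (hs : 3 / 2 < s) (f : Sobolev s) (x : UnitAddCircle) :
    circleDeriv f x = derivCLM hs f x := by
  obtain ⟨y, rfl⟩ := QuotientAddGroup.mk_surjective x
  have h : HasDerivAt (fun t : ℝ => f ((y + t : ℝ) : UnitAddCircle))
      (derivCLM hs f ((y + 0 : ℝ) : UnitAddCircle)) 0 :=
    (hasDerivAt_coe hs f (y + 0)).comp_const_add y 0
  rw [add_zero] at h
  exact h.deriv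

theorem integral_derivCLM {s : ℝ} (hs : 3 / 2 < s) (f : Sobolev s) :
    ∫ x, derivCLM hs f x = 0 := by
  have h := coeff_zero (derivCLM hs f)
  rw [coeff_derivCLM] at h
  simpa using h.symm

theorem eq_of_derivCLM_eq {s : ℝ} (hs : 3 / 2 < s) {u w : sobolevZero s}
    (h : derivCLM hs u = derivCLM hs w) : u = w := by
  have h0 : ∀ t : ℝ, HasDerivAt (fun t : ℝ => (u - w : Sobolev s) (t : UnitAddCircle)) 0 t := by
    intro t
    have := hasDerivAt_coe hs (u - w : Sobolev s) t
    rwa [map_sub, h, sub_self] at this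
  refine Subtype.ext (ext_apply fun x => ?_)
  obtain ⟨y, rfl⟩ := QuotientAddGroup.mk_surjective x
  have h1 := is_const_of_deriv_eq_zero (fun t => (h0 t).differentiableAt)
    (fun t => (h0 t).deriv) y 0
  have h2 : (u : Sobolev s) 0 = 0 := u.2
  have h3 : (w : Sobolev s) 0 = 0 := w.2
  simp only [sub_apply, AddCircle.coe_zero, h2, h3, sub_zero] at h1
  exact sub_eq_zero.mp h1

/-- Division by `2πik` gains one order, as `√(1 + k²) ≤ 2π|k|` for `k ≠ 0`. At `k = 0` the
convention `0⁻¹ = 0` discards the mean. -/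
theorem exists_primitive {s : ℝ} (hs : 3 / 2 < s) : ∃ P : Sobolev (s - 1) →L[ℝ] Sobolev s,
    ∀ f k, (P f).coeff k = (2 * Real.pi * Complex.I * k)⁻¹ * f.coeff k := by
  refine exists_multiplier (by linarith) (fun k => by simp [Complex.conj_ofNat])
    zero_le_one fun k => ?_
  have e : ‖(2 * (Real.pi : ℂ) * Complex.I * k)⁻¹‖ = (2 * Real.pi * |(k : ℝ)|)⁻¹ := by
    rw [← Complex.ofReal_intCast, norm_inv, norm_mul, norm_mul, norm_mul, Complex.norm_I,
      Complex.norm_real, Complex.norm_real, Real.norm_of_nonneg Real.pi_pos.le]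
    simp
  rw [e, sobolevWeight_eq_mul s, one_mul, mul_assoc]
  refine mul_le_of_le_one_right (sobolevWeight_pos _ k).le ?_
  by_cases hk : k = 0
  · subst hk; simp
  have h1 : 1 ≤ |(k : ℝ)| := by
    rw [← Int.cast_abs]
    exact_mod_cast Int.one_le_abs hk
  have h2 : √(1 + (k : ℝ) ^ 2) ≤ 2 * Real.pi * |(k : ℝ)| := by
    have h3 : √(1 + (k : ℝ) ^ 2) ≤ 2 * |(k : ℝ)| := by
      rw [Real.sqrt_le_left (by positivity), ← sq_abs (k : ℝ)]
      nlinarith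
    have := Real.pi_gt_three
    nlinarith
  rw [← div_eq_mul_inv, div_le_one (by positivity)]
  exact h2

theorem exists_primitiveZero {s : ℝ} (hs : 3 / 2 < s) :
    ∃ P : Sobolev (s - 1) →L[ℝ] sobolevZero s,
      ∀ f, derivCLM hs (P f) = f - (∫ x, f x) • one (s - 1) := by
  obtain ⟨P, hP⟩ := exists_primitive hs
  have hs' : 1 / 2 < s := by linarith
  -- Subtracting the constant `P f 0` lands in `H₀^s` without changing the derivative.
  let P₀ : Sobolev (s - 1) →L[ℝ] Sobolev s := P - ((ev hs' 0).comp P).smulRight (one s)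
  have hP₀ : ∀ f, P₀ f = P f - P f 0 • one s := fun f => rfl
  have hD1 : derivCLM hs (one s) = 0 := ext_coeff fun k => by
    have h0 : ∀ k, (0 : Sobolev (s - 1)).coeff k = 0 := fun k => by
      simpa using coeff_smul (0 : ℝ) (0 : Sobolev (s - 1)) k
    rw [coeff_derivCLM, h0]
    by_cases hk : k = 0
    · subst hk; simp
    · rw [coeff_one_of_ne hk, mul_zero]
  refine ⟨P₀.codRestrict (sobolevZero s) fun f => ?_, fun f => ?_⟩
  · change P₀ f 0 = 0
    rw [hP₀, sub_apply, smul_apply, one_apply, mul_one, sub_self]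
  · change derivCLM hs (P₀ f) = _
    rw [hP₀, map_sub, map_smul, hD1, smul_zero, sub_zero]
    refine ext_coeff fun k => ?_
    rw [coeff_derivCLM, hP, coeff_sub, coeff_smul]
    by_cases hk : k = 0
    · subst hk
      rw [coeff_one_zero, coeff_zero f]
      simp
    · rw [coeff_one_of_ne hk, mul_zero, sub_zero, mul_inv_cancel_left₀]
      have := Real.pi_ne_zero
      simp [hk]

/-- The primitive `H^{s-1} → H₀^s` of the part of mean zero. -/
def primitive {s : ℝ} (hs : 3 / 2 < s) : Sobolev (s - 1) →L[ℝ] sobolevZero s :=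
  (exists_primitiveZero hs).choose

theorem derivCLM_primitive {s : ℝ} (hs : 3 / 2 < s) (f : Sobolev (s - 1)) :
    derivCLM hs (primitive hs f) = f - (∫ x, f x) • one (s - 1) :=
  (exists_primitiveZero hs).choose_spec f

/-- The derivative `φₓ = 1 + vₓ` as an element of `H^{s-1}`. -/
def phiS {s : ℝ} (hs : 3 / 2 < s) (v : sobolevZero s) : Sobolev (s - 1) :=
  one (s - 1) + derivCLM hs v

theorem phiS_apply {s : ℝ} (hs : 3 / 2 < s) (v : sobolevZero s) (x : UnitAddCircle) :
    phiS hs v x = phiDeriv v x := by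
  rw [phiS, add_apply, one_apply, phiDeriv, circleDeriv_eq hs]

theorem integral_phiS {s : ℝ} (hs : 3 / 2 < s) (v : sobolevZero s) : ∫ x, phiS hs v x = 1 := by
  simp only [phiS, add_apply, one_apply]
  rw [integral_add (integrable_const _) (integrable _), integral_derivCLM]
  simp

theorem contDiff_phiS {s : ℝ} (hs : 3 / 2 < s) : ContDiff ℝ ∞ (phiS hs) :=
  contDiff_const.add ((derivCLM hs).comp (sobolevZero s).subtypeL).contDiff

theorem phiS_injective {s : ℝ} (hs : 3 / 2 < s) : Function.Injective (phiS hs) := fun _ _ h =>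
  eq_of_derivCLM_eq hs (add_left_cancel h)

theorem phiS_primitive {s : ℝ} (hs : 3 / 2 < s) {f : Sobolev (s - 1)} (hf : ∫ x, f x = 1) :
    phiS hs (primitive hs f) = f := by
  rw [phiS, derivCLM_primitive, hf, one_smul, add_sub_cancel]

end Sobolev

open Sobolev

/-- A map `id + v` of the circle fixing `0` and with positive derivative is a bijection. -/
theorem bijective_of_phiDeriv_pos {s : ℝ} (hs : 3 / 2 < s) {v : sobolevZero s}
    (hv : ∀ x, 0 < phiDeriv v x) : Function.Bijective
      (fun x : UnitAddCircle => x + (((v : Sobolev s) x : ℝ) : UnitAddCircle)) := by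
  let F : ℝ → ℝ := fun t => t + (v : Sobolev s) (t : UnitAddCircle)
  have hF : ∀ t : ℝ, HasDerivAt F (phiDeriv v (t : UnitAddCircle)) t := fun t => by
    rw [← phiS_apply hs]
    exact (hasDerivAt_id t).add (hasDerivAt_coe hs v t)
  have hmono : StrictMono F := strictMono_of_deriv_pos fun t => by
    rw [(hF t).deriv]; exact hv _
  have hcont : Continuous F := continuous_iff_continuousAt.mpr fun t => (hF t).continuousAt
  have hv0 : (v : Sobolev s) 0 = 0 := v.2
  have hF0 : F 0 = 0 := by simp [F, hv0]
  have hF1 : F 1 = 1 := by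
    have : ((1 : ℝ) : UnitAddCircle) = 0 := AddCircle.coe_period 1
    simp [F, this, hv0]
  have hcoe : ∀ t : ℝ, (t : UnitAddCircle) + (((v : Sobolev s) (t : UnitAddCircle) : ℝ) :
      UnitAddCircle) = ((F t : ℝ) : UnitAddCircle) := fun t => rfl
  have hrep : ∀ x : UnitAddCircle, ∃ t ∈ Set.Ico (0 : ℝ) (0 + 1), (t : UnitAddCircle) = x :=
    fun x => by
      have : x ∈ ((↑) : ℝ → UnitAddCircle) '' Set.Ico (0 : ℝ) (0 + 1) := by
        rw [AddCircle.coe_image_Ico_eq]; trivial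
      exact this
  -- The lift `F` is increasing with `F 0 = 0` and `F 1 = 1`, so it preserves the fundamental
  -- domain, where equality on the circle is equality in `ℝ`.
  have hFmem : ∀ t ∈ Set.Ico (0 : ℝ) (0 + 1), F t ∈ Set.Ico (0 : ℝ) (0 + 1) := fun t ht => by
    rw [zero_add] at *
    exact ⟨hF0 ▸ hmono.monotone ht.1, hF1 ▸ hmono ht.2⟩
  constructor
  · intro x y hxy
    obtain ⟨a, ha, rfl⟩ := hrep x
    obtain ⟨b, hb, rfl⟩ := hrep y
    have h : ((F a : ℝ) : UnitAddCircle) = ((F b : ℝ) : UnitAddCircle) := hxy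
    rw [AddCircle.coe_eq_coe_iff_of_mem_Ico (hFmem a ha) (hFmem b hb)] at h
    rw [hmono.injective h]
  · intro y
    obtain ⟨c, hc, rfl⟩ := hrep y
    rw [zero_add] at hc
    obtain ⟨a, -, ha⟩ := intermediate_value_Icc zero_le_one hcont.continuousOn
      (show c ∈ Set.Icc (F 0) (F 1) by rw [hF0, hF1]; exact ⟨hc.1, hc.2.le⟩)
    exact ⟨a, by rw [← ha]; exact hcoe a⟩

/-- Bijectivity is automatic, so `Diff0` is cut out by a positivity condition that is open in the
Sobolev topology. -/
theorem mem_Diff0_iff {s : ℝ} (hs : 3 / 2 < s) {v : sobolevZero s} :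
    v ∈ Diff0 s ↔ ∀ x, 0 < phiS hs v x := by
  simp only [phiS_apply]
  exact ⟨fun h => h.2, fun h => ⟨bijective_of_phiDeriv_pos hs h, h⟩⟩

theorem isOpen_Diff0 {s : ℝ} (hs : 3 / 2 < s) : IsOpen (Diff0 s) := by
  have h := (isOpen_pos (s := s - 1) (by linarith)).preimage (contDiff_phiS hs).continuous
  have e : Diff0 s = phiS hs ⁻¹' {f | ∀ x, 0 < f x} := Set.ext fun v => mem_Diff0_iff hs
  rwa [e]

theorem isOpen_G {s : ℝ} (hs : 3 / 2 < s) : IsOpen (G s) :=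
  (isOpen_Diff0 hs).preimage continuous_fst

theorem isOpen_K {s : ℝ} (hs : 3 / 2 < s) : IsOpen (K s) :=
  (isOpen_Diff0 hs).preimage continuous_fst

/-! ### The map `Φ` and its inverse -/

/-- The map `(id + v, α) ↦ √φₓ (cosh(α/2), sinh(α/2))`, written in light-cone coordinates. -/
def phiMap {s : ℝ} (hs : 5 / 2 < s) (g : TG s) : Pair (s - 1) :=
  have hr : 1 / 2 < s - 1 := by linarith
  ((1 / 2 : ℝ) • (expS hr ((1 / 2 : ℝ) • (logS hr (phiS (by linarith) g.1) + g.2)) +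
      expS hr ((1 / 2 : ℝ) • (logS hr (phiS (by linarith) g.1) - g.2))),
    (1 / 2 : ℝ) • (expS hr ((1 / 2 : ℝ) • (logS hr (phiS (by linarith) g.1) + g.2)) -
      expS hr ((1 / 2 : ℝ) • (logS hr (phiS (by linarith) g.1) - g.2))))

/-- Translates the light-cone factors of `phiMap` into `√φₓ exp(±α/2)`; square roots and hyperbolic
functions thus reduce to `expS` and `logS`. -/
theorem exp_half_log_add {ρ : ℝ} (hρ : 0 < ρ) (α : ℝ) :
    Real.exp (1 / 2 * (Real.log ρ + α)) = √ρ * Real.exp (α / 2) := by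
  rw [Real.sqrt_eq_rpow, Real.rpow_def_of_pos hρ, ← Real.exp_add]
  congr 1
  ring

theorem phiMap_fst {s : ℝ} (hs : 5 / 2 < s) {g : TG s} (hg : g ∈ G s) (x : UnitAddCircle) :
    (phiMap hs g).1 x = √(phiDeriv g.1 x) * Real.cosh (g.2 x / 2) := by
  have hpos := (mem_Diff0_iff (by linarith)).mp hg
  simp only [phiMap, smul_apply, add_apply, expS_apply, logS_apply _ hpos, sub_apply]
  rw [sub_eq_add_neg (Real.log _), exp_half_log_add (hpos x), exp_half_log_add (hpos x), phiS_apply,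
    Real.cosh_eq, neg_div]
  ring

theorem phiMap_snd {s : ℝ} (hs : 5 / 2 < s) {g : TG s} (hg : g ∈ G s) (x : UnitAddCircle) :
    (phiMap hs g).2 x = √(phiDeriv g.1 x) * Real.sinh (g.2 x / 2) := by
  have hpos := (mem_Diff0_iff (by linarith)).mp hg
  simp only [phiMap, smul_apply, add_apply, expS_apply, logS_apply _ hpos, sub_apply]
  rw [sub_eq_add_neg (Real.log _), exp_half_log_add (hpos x), exp_half_log_add (hpos x), phiS_apply,
    Real.sinh_eq, neg_div]
  ring

theorem phiMap_sq_sub_sq {s : ℝ} (hs : 5 / 2 < s) {g : TG s} (hg : g ∈ G s) (x : UnitAddCircle) :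
    (phiMap hs g).1 x ^ 2 - (phiMap hs g).2 x ^ 2 = phiDeriv g.1 x := by
  rw [phiMap_fst hs hg, phiMap_snd hs hg, mul_pow, mul_pow, Real.sq_sqrt (hg.2 x).le,
    Real.cosh_sq]
  ring

theorem phiMap_mem {s : ℝ} (hs : 5 / 2 < s) {g : TG s} (hg : g ∈ G s) : phiMap hs g ∈ U (s - 1) := by
  refine ⟨?_, fun x => ⟨?_, ?_⟩⟩
  · change ∫ x, _ = _
    simp only [phiMap_sq_sub_sq hs hg, ← phiS_apply (show 3 / 2 < s by linarith)]
    exact integral_phiS _ _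
  · rw [phiMap_fst hs hg]
    exact mul_pos (Real.sqrt_pos.mpr (hg.2 x)) (Real.cosh_pos _)
  · rw [phiMap_sq_sub_sq hs hg]
    exact hg.2 x

theorem contDiffOn_phiMap {s : ℝ} (hs : 5 / 2 < s) : ContDiffOn ℝ ∞ (phiMap hs) (G s) := by
  intro g hg
  refine ContDiffAt.contDiffWithinAt ?_
  have hr : 1 / 2 < s - 1 := by linarith
  have hpos := (mem_Diff0_iff (by linarith)).mp hg
  have h1 : ContDiffAt ℝ ∞ (fun g : TG s => logS hr (phiS (by linarith) g.1)) g :=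
    ContDiffAt.comp g (contDiffAt_logS hr hpos)
      ((contDiff_phiS (by linarith)).comp contDiff_fst).contDiffAt
  have h2 := (contDiff_expS hr).contDiffAt.comp g ((h1.add contDiffAt_snd).const_smul (1 / 2 : ℝ))
  have h3 := (contDiff_expS hr).contDiffAt.comp g ((h1.sub contDiffAt_snd).const_smul (1 / 2 : ℝ))
  exact ((h2.add h3).const_smul (1 / 2 : ℝ)).prodMk ((h2.sub h3).const_smul (1 / 2 : ℝ))

/-- The inverse of `phiMap`, extended to an open set of pairs. -/
def phiInv {s : ℝ} (hs : 5 / 2 < s) (f : Pair (s - 1)) : TG s :=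
  have hr : 1 / 2 < s - 1 := by linarith
  (primitive (by linarith) (mulCLM hr f.1 f.1 - mulCLM hr f.2 f.2),
    logS hr (f.1 + f.2) - logS hr (f.1 - f.2))

/-- The pairs with `|f₂| < f₁`. -/
def lightCone (r : ℝ) : Set (Pair r) :=
  {f | (∀ x, 0 < (f.1 + f.2) x) ∧ ∀ x, 0 < (f.1 - f.2) x}

theorem isOpen_lightCone {r : ℝ} (hr : 1 / 2 < r) : IsOpen (lightCone r) :=
  ((isOpen_pos hr).preimage (continuous_fst.add continuous_snd)).inter
    ((isOpen_pos hr).preimage (continuous_fst.sub continuous_snd))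

theorem U_subset_lightCone {r : ℝ} : U r ⊆ lightCone r := by
  intro f hf
  have h : ∀ x, |f.2 x| < f.1 x := fun x =>
    abs_lt_of_sq_lt_sq (by linarith [(hf.2 x).2]) (hf.2 x).1.le
  refine ⟨fun x => ?_, fun x => ?_⟩
  · rw [Sobolev.add_apply]
    linarith [(abs_lt.mp (h x)).1]
  · rw [Sobolev.sub_apply]
    linarith [(abs_lt.mp (h x)).2]

theorem contDiffOn_phiInv {s : ℝ} (hs : 5 / 2 < s) :
    ContDiffOn ℝ ∞ (phiInv hs) (lightCone (s - 1)) := by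
  intro f hf
  refine ContDiffAt.contDiffWithinAt ?_
  have hr : 1 / 2 < s - 1 := by linarith
  have h1 : ContDiffAt ℝ ∞ (fun f : Pair (s - 1) => mulCLM hr f.1 f.1) f :=
    ((mulCLM hr).contDiff.contDiffAt.comp f contDiffAt_fst).clm_apply contDiffAt_fst
  have h2 : ContDiffAt ℝ ∞ (fun f : Pair (s - 1) => mulCLM hr f.2 f.2) f :=
    ((mulCLM hr).contDiff.contDiffAt.comp f contDiffAt_snd).clm_apply contDiffAt_snd
  have h3 : ContDiffAt ℝ ∞ (fun f : Pair (s - 1) => logS hr (f.1 + f.2)) f :=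
    ContDiffAt.comp f (contDiffAt_logS hr hf.1) (contDiffAt_fst.add contDiffAt_snd)
  have h4 : ContDiffAt ℝ ∞ (fun f : Pair (s - 1) => logS hr (f.1 - f.2)) f :=
    ContDiffAt.comp f (contDiffAt_logS hr hf.2) (contDiffAt_fst.sub contDiffAt_snd)
  exact ((primitive (s := s) (by linarith)).contDiff.contDiffAt.comp f (h1.sub h2)).prodMk
    (h3.sub h4)

theorem phiInv_snd_apply {s : ℝ} (hs : 5 / 2 < s) {f : Pair (s - 1)} (hf : f ∈ U (s - 1))
    (x : UnitAddCircle) :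
    (phiInv hs f).2 x = Real.log (f.1 x + f.2 x) - Real.log (f.1 x - f.2 x) := by
  obtain ⟨h1, h2⟩ := U_subset_lightCone hf
  simp only [phiInv, sub_apply, logS_apply _ h1, logS_apply _ h2, add_apply]

/-- The pseudosphere condition is used here: the mean 1 removed by `primitive` is the constant 1
that `phiS` adds back. -/
theorem phiDeriv_phiInv {s : ℝ} (hs : 5 / 2 < s) {f : Pair (s - 1)} (hf : f ∈ U (s - 1))
    (x : UnitAddCircle) : phiDeriv (phiInv hs f).1 x = f.1 x ^ 2 - f.2 x ^ 2 := by
  rw [← phiS_apply (by linarith), phiInv, phiS_primitive]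
  · simp only [sub_apply, mulCLM_apply]
    ring
  · simp only [sub_apply, mulCLM_apply, ← sq]
    exact hf.1

theorem phiInv_mem {s : ℝ} (hs : 5 / 2 < s) {f : Pair (s - 1)} (hf : f ∈ U (s - 1)) :
    phiInv hs f ∈ G s :=
  (mem_Diff0_iff (by linarith)).mpr fun x => by
    rw [phiS_apply, phiDeriv_phiInv hs hf]
    exact (hf.2 x).2

theorem phiInv_phiMap {s : ℝ} (hs : 5 / 2 < s) {g : TG s} (hg : g ∈ G s) :
    phiInv hs (phiMap hs g) = g := by
  have hm := phiMap_mem hs hg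
  refine Prod.ext (phiS_injective (by linarith : 3 / 2 < s) (ext_apply fun x => ?_))
    (ext_apply fun x => ?_)
  · rw [phiS_apply, phiS_apply, phiDeriv_phiInv hs hm, phiMap_sq_sub_sq hs hg]
  · have h0 := (Real.sqrt_pos.mpr (hg.2 x)).ne'
    rw [phiInv_snd_apply hs hm, phiMap_fst hs hg, phiMap_snd hs hg, ← mul_add, ← mul_sub,
      Real.cosh_add_sinh, Real.cosh_sub_sinh, Real.log_mul h0 (Real.exp_pos _).ne',
      Real.log_mul h0 (Real.exp_pos _).ne', Real.log_exp, Real.log_exp]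
    ring

theorem phiMap_phiInv {s : ℝ} (hs : 5 / 2 < s) {f : Pair (s - 1)} (hf : f ∈ U (s - 1)) :
    phiMap hs (phiInv hs f) = f := by
  obtain ⟨h1, h2⟩ := U_subset_lightCone hf
  have hg := phiInv_mem hs hf
  have key : ∀ x, phiDeriv (phiInv hs f).1 x = (f.1 x + f.2 x) * (f.1 x - f.2 x) := fun x => by
    rw [phiDeriv_phiInv hs hf]
    ring
  have e1 : ∀ x, √(phiDeriv (phiInv hs f).1 x) * Real.exp ((phiInv hs f).2 x / 2)
      = f.1 x + f.2 x := fun x => by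
    have h1x := h1 x
    have h2x := h2 x
    rw [Sobolev.add_apply] at h1x
    rw [Sobolev.sub_apply] at h2x
    rw [← exp_half_log_add (hg.2 x), key, Real.log_mul h1x.ne' h2x.ne', phiInv_snd_apply hs hf]
    conv_rhs => rw [← Real.exp_log h1x]
    congr 1
    ring
  have e2 : ∀ x, √(phiDeriv (phiInv hs f).1 x) * Real.exp (-((phiInv hs f).2 x / 2))
      = f.1 x - f.2 x := fun x => by
    have h1x := h1 x
    have h2x := h2 x
    rw [Sobolev.add_apply] at h1x
    rw [Sobolev.sub_apply] at h2x
    rw [← neg_div, ← exp_half_log_add (hg.2 x), key, Real.log_mul h1x.ne' h2x.ne',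
      phiInv_snd_apply hs hf]
    conv_rhs => rw [← Real.exp_log h2x]
    congr 1
    ring
  refine Prod.ext (ext_apply fun x => ?_) (ext_apply fun x => ?_)
  · rw [phiMap_fst hs hg, Real.cosh_eq]
    linear_combination (e1 x + e2 x) / 2
  · rw [phiMap_snd hs hg, Real.sinh_eq]
    linear_combination (e1 x - e2 x) / 2

/-- The map `Φ : G^s → U^{s-1}`. -/
def Phi {s : ℝ} (hs : 5 / 2 < s) (g : G s) : U (s - 1) := ⟨phiMap hs g.1, phiMap_mem hs g.2⟩

/-- The inverse of `Φ`. -/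
def PhiInv {s : ℝ} (hs : 5 / 2 < s) (f : U (s - 1)) : G s := ⟨phiInv hs f.1, phiInv_mem hs f.2⟩

theorem PhiInv_Phi {s : ℝ} (hs : 5 / 2 < s) : Function.LeftInverse (PhiInv hs) (Phi hs) :=
  fun g => Subtype.ext (phiInv_phiMap hs g.2)

theorem Phi_PhiInv {s : ℝ} (hs : 5 / 2 < s) : Function.RightInverse (PhiInv hs) (Phi hs) :=
  fun f => Subtype.ext (phiMap_phiInv hs f.2)

theorem Phi_vadd {s : ℝ} (hs : 5 / 2 < s) (β : ℝ) (g : G s) :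
    Phi hs (β +ᵥ g) = β +ᵥ Phi hs g := by
  have h1 : ∀ x, (β +ᵥ g).1.2 x / 2 = g.1.2 x / 2 - β := fun x => by
    change (g.1.2.toC x - 2 * β * 1) / 2 = _
    ring
  have h2 : (β +ᵥ g).1.1 = g.1.1 := rfl
  refine Subtype.ext (Prod.ext (ext_apply fun x => ?_) (ext_apply fun x => ?_))
  · change (phiMap hs (β +ᵥ g).1).1 x = (boost (s - 1) β (phiMap hs g.1)).1 x
    rw [boost_fst, phiMap_fst hs (β +ᵥ g).2, phiMap_fst hs g.2, phiMap_snd hs g.2, h1, h2,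
      Real.cosh_sub]
    ring
  · change (phiMap hs (β +ᵥ g).1).2 x = (boost (s - 1) β (phiMap hs g.1)).2 x
    rw [boost_snd, phiMap_snd hs (β +ᵥ g).2, phiMap_fst hs g.2, phiMap_snd hs g.2, h1, h2,
      Real.sinh_sub]
    ring

/-! ### The map `Ψ` -/

theorem exists_section {r : ℝ} (hr : 1 / 2 < r) : ∃ S : SobolevModConst r →L[ℝ] Sobolev r,
    ∀ f : Sobolev r, S (Submodule.Quotient.mk f) = f - f 0 • one r := by
  let T : Sobolev r →L[ℝ] Sobolev r :=
    ContinuousLinearMap.id ℝ (Sobolev r) - (ev hr 0).smulRight (one r)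
  have hT : ∀ f, T f = f - f 0 • one r := fun f => rfl
  have hker : constants r ≤ T.ker := by
    rw [constants, Submodule.span_singleton_le_iff_mem]
    change T (one r) = 0
    rw [hT, one_apply, one_smul, sub_self]
  exact ⟨(constants r).liftQL T hker, fun f => hT f⟩

/-- The representative of a class modulo constants that vanishes at `0`. -/
def modConstSection {r : ℝ} (hr : 1 / 2 < r) : SobolevModConst r →L[ℝ] Sobolev r :=
  (exists_section hr).choose

theorem modConstSection_mk {r : ℝ} (hr : 1 / 2 < r) (f : Sobolev r) :
    modConstSection hr (Submodule.Quotient.mk f) = f - f 0 • one r :=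
  (exists_section hr).choose_spec f

theorem mk_modConstSection {r : ℝ} (hr : 1 / 2 < r) (a : SobolevModConst r) :
    Submodule.Quotient.mk (modConstSection hr a) = a := by
  obtain ⟨f, rfl⟩ := Submodule.Quotient.mk_surjective _ a
  rw [modConstSection_mk, Submodule.Quotient.eq, sub_sub_cancel_left]
  exact neg_mem (Submodule.smul_mem _ _ (Submodule.mem_span_singleton_self _))

/-- `Quotient.out` need not be linear, but it differs from the continuous linear section by a
constant, which `piProj` does not see. -/
theorem out_apply {r : ℝ} (hr : 1 / 2 < r) (a : SobolevModConst r) (x : UnitAddCircle) :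
    (Quotient.out a : Sobolev r) x = modConstSection hr a x + (Quotient.out a : Sobolev r) 0 := by
  have h : Submodule.Quotient.mk (Quotient.out a : Sobolev r) = a := Quotient.out_eq a
  have h1 := modConstSection_mk hr (Quotient.out a : Sobolev r)
  rw [h] at h1
  rw [h1, Sobolev.sub_apply, Sobolev.smul_apply, one_apply]
  ring

/-- A smooth section of `p` on `K^s`. -/
def kSection {s : ℝ} (hs : 5 / 2 < s) (a : TK s) : TG s :=
  (a.1, modConstSection (by linarith) a.2)

/-- By equivariance and injectivity of `Φ`, boost orbits pull back to the orbits of `α ↦ α - 2β`,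
which are the fibres of `p`. This gives both that `Ψ` is well defined and that it is injective. -/
theorem q_Phi_eq_iff {s : ℝ} (hs : 5 / 2 < s) (g g' : G s) :
    q (s - 1) (Phi hs g) = q (s - 1) (Phi hs g') ↔ p s g = p s g' := by
  have h1 : q (s - 1) (Phi hs g) = q (s - 1) (Phi hs g') ↔
      ∃ β : ℝ, β +ᵥ Phi hs g' = Phi hs g := by
    unfold q
    rw [Quotient.eq]
    exact AddAction.orbitRel_apply
  rw [h1]
  constructor
  · rintro ⟨β, hβ⟩
    rw [← Phi_vadd] at hβ
    rw [← (PhiInv_Phi hs).injective hβ]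
    refine Subtype.ext (Prod.ext rfl ((Submodule.Quotient.eq _).mpr ?_))
    change g'.1.2 - (2 * β) • one (s - 1) - g'.1.2 ∈ constants (s - 1)
    rw [sub_sub_cancel_left]
    exact neg_mem (Submodule.smul_mem _ _ (Submodule.mem_span_singleton_self _))
  · intro h
    have h2 : g.1.1 = g'.1.1 := congrArg (fun a => a.1.1) h
    have h3 : (Submodule.Quotient.mk g'.1.2 : SobolevModConst (s - 1))
      = Submodule.Quotient.mk g.1.2 := (congrArg (fun a => a.1.2) h).symm
    obtain ⟨c, hc⟩ := Submodule.mem_span_singleton.mp ((Submodule.Quotient.eq _).mp h3)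
    refine ⟨c / 2, ?_⟩
    rw [← Phi_vadd]
    congr 1
    refine Subtype.ext (Prod.ext h2.symm ?_)
    change g'.1.2 - (2 * (c / 2)) • one (s - 1) = g.1.2
    rw [mul_div_cancel₀ _ two_ne_zero, hc, sub_sub_cancel]

/-- The map `Ψ : K^s → V^{s-1}`. -/
def Psi {s : ℝ} (hs : 5 / 2 < s) (a : K s) : V (s - 1) :=
  q (s - 1) (Phi hs ⟨kSection hs a.1, a.2⟩)

theorem p_kSection {s : ℝ} (hs : 5 / 2 < s) (a : K s) :
    p s ⟨kSection hs a.1, a.2⟩ = a :=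
  Subtype.ext (Prod.ext rfl (mk_modConstSection _ _))

theorem Psi_p {s : ℝ} (hs : 5 / 2 < s) (g : G s) : Psi hs (p s g) = q (s - 1) (Phi hs g) :=
  (q_Phi_eq_iff hs _ _).mpr (p_kSection hs (p s g))

theorem bijective_Psi {s : ℝ} (hs : 5 / 2 < s) : Function.Bijective (Psi hs) := by
  constructor
  · intro a b h
    have := (q_Phi_eq_iff hs _ _).mp h
    rwa [p_kSection, p_kSection] at this
  · intro y
    obtain ⟨f, rfl⟩ := Quotient.exists_rep y
    refine ⟨p s (PhiInv hs f), ?_⟩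
    rw [Psi_p, Phi_PhiInv hs f]
    rfl

/-! ### Smoothness -/

theorem isSmoothMap_Phi {s : ℝ} (hs : 5 / 2 < s) :
    IsSmoothMap (id : U (s - 1) → U (s - 1)) (Phi hs) := fun a =>
  ⟨phiMap hs, G s, isOpen_G (by linarith), a.2, contDiffOn_phiMap hs,
    fun b _ => ⟨phiMap_mem hs b.2, rfl⟩⟩

theorem isSmoothMap_PhiInv {s : ℝ} (hs : 5 / 2 < s) :
    IsSmoothMap (id : G s → G s) (PhiInv hs) := fun a =>
  ⟨phiInv hs, lightCone (s - 1), isOpen_lightCone (by linarith), U_subset_lightCone a.2,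
    contDiffOn_phiInv hs, fun b _ => ⟨phiInv_mem hs b.2, rfl⟩⟩

theorem isSmoothMap_Psi {s : ℝ} (hs : 5 / 2 < s) : IsSmoothMap (q (s - 1)) (Psi hs) := fun a => by
  have hk : ContDiff ℝ ∞ (kSection hs) :=
    contDiff_fst.prodMk ((modConstSection (r := s - 1) (by linarith)).contDiff.comp contDiff_snd)
  exact ⟨fun b => phiMap hs (kSection hs b), K s, isOpen_K (by linarith), a.2,
    (contDiffOn_phiMap hs).comp hk.contDiffOn (fun b hb => hb),
    fun b _ => ⟨phiMap_mem hs (g := kSection hs b) b.2, rfl⟩⟩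

/-- Smoothness of the inverse of `Ψ` is tested after composition with `q`, where it becomes this
map; `phiInv` is smooth on the whole open light cone. -/
theorem isSmoothMap_p_PhiInv {s : ℝ} (hs : 5 / 2 < s) :
    IsSmoothMap (id : K s → K s) (p s ∘ PhiInv hs) := fun a => by
  have hp : ContDiff ℝ ∞ (fun g : TG s => ((g.1, (constants (s - 1)).mkQL g.2) : TK s)) :=
    contDiff_fst.prodMk ((constants (s - 1)).mkQL.contDiff.comp contDiff_snd)
  exact ⟨fun f => ((phiInv hs f).1, (constants (s - 1)).mkQL (phiInv hs f).2), lightCone (s - 1),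
    isOpen_lightCone (by linarith), U_subset_lightCone a.2,
    hp.comp_contDiffOn (contDiffOn_phiInv hs), fun b _ => ⟨phiInv_mem hs b.2, rfl⟩⟩

/-! ### Derivatives of representatives -/

section Derivatives

variable {s : ℝ} {γ : ℝ → Pair (s - 1)} {f Y : Pair (s - 1)}

theorem hasDerivAt_fst_apply (hs : 5 / 2 < s) (hγ : HasDerivAt γ Y 0) (x : UnitAddCircle) :
    HasDerivAt (fun t => (γ t).1 x) (Y.1 x) 0 :=
  let T : Pair (s - 1) →L[ℝ] ℝ :=
    (ev (s := s - 1) (by linarith) x).comp (ContinuousLinearMap.fst ℝ _ _)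
  T.hasFDerivAt.comp_hasDerivAt 0 hγ

theorem hasDerivAt_snd_apply (hs : 5 / 2 < s) (hγ : HasDerivAt γ Y 0) (x : UnitAddCircle) :
    HasDerivAt (fun t => (γ t).2 x) (Y.2 x) 0 :=
  let T : Pair (s - 1) →L[ℝ] ℝ :=
    (ev (s := s - 1) (by linarith) x).comp (ContinuousLinearMap.snd ℝ _ _)
  T.hasFDerivAt.comp_hasDerivAt 0 hγ

theorem hasDerivAt_sq_sub_sq (hs : 5 / 2 < s) (hγ : HasDerivAt γ Y 0) (h0 : γ 0 = f)
    (x : UnitAddCircle) : HasDerivAt (fun t => (γ t).1 x ^ 2 - (γ t).2 x ^ 2)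
      (2 * (f.1 x * Y.1 x - f.2 x * Y.2 x)) 0 := by
  have h := ((hasDerivAt_fst_apply hs hγ x).pow 2).sub ((hasDerivAt_snd_apply hs hγ x).pow 2)
  rw [h0] at h
  refine h.congr_deriv ?_
  simp only [Nat.add_one_sub_one, pow_one, Nat.cast_ofNat]
  ring

theorem hasDerivAt_log_sub_log (hs : 5 / 2 < s) (hγ : HasDerivAt γ Y 0) (h0 : γ 0 = f)
    (hf : f ∈ U (s - 1)) (x : UnitAddCircle) :
    HasDerivAt (fun t => Real.log ((γ t).1 x + (γ t).2 x) - Real.log ((γ t).1 x - (γ t).2 x))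
      (2 * (f.1 x * Y.2 x - f.2 x * Y.1 x) / (f.1 x ^ 2 - f.2 x ^ 2)) 0 := by
  obtain ⟨h1, h2⟩ := U_subset_lightCone hf
  have h1x : 0 < f.1 x + f.2 x := h1 x
  have h2x : 0 < f.1 x - f.2 x := h2 x
  have hd1 := hasDerivAt_fst_apply hs hγ x
  have hd2 := hasDerivAt_snd_apply hs hγ x
  have h := ((hd1.add hd2).log (by simpa [h0] using h1x.ne')).sub
    ((hd1.sub hd2).log (by simpa [h0] using h2x.ne'))
  refine h.congr_deriv ?_
  simp only [Pi.add_apply, Pi.sub_apply, h0]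
  have h3 : f.1 x ^ 2 - f.2 x ^ 2 = (f.1 x + f.2 x) * (f.1 x - f.2 x) := by ring
  rw [h3]
  field_simp
  ring

end Derivatives

theorem hasDerivAt_line {E F : Type*} [NormedAddCommGroup E] [NormedSpace ℝ E]
    [NormedAddCommGroup F] [NormedSpace ℝ F] {g : E → F} {a : E} (hg : DifferentiableAt ℝ g a)
    (X : E) : HasDerivAt (fun t : ℝ => g (a + t • X)) (fderiv ℝ g a X) 0 := by
  have h1 : HasDerivAt (fun t : ℝ => a + t • X) X 0 := by
    simpa using ((hasDerivAt_id (0 : ℝ)).smul_const X).const_add a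
  have h2 : HasFDerivAt g (fderiv ℝ g a) (a + (0 : ℝ) • X) := by
    simpa using hg.hasFDerivAt
  exact h2.comp_hasDerivAt 0 h1

theorem eventually_line_mem {E : Type*} [NormedAddCommGroup E] [NormedSpace ℝ E] {W : Set E}
    (hW : IsOpen W) {a : E} (ha : a ∈ W) (X : E) : ∀ᶠ t : ℝ in 𝓝 0, a + t • X ∈ W := by
  have h : Continuous fun t : ℝ => a + t • X := by fun_prop
  exact h.continuousAt.eventually_mem (hW.mem_nhds (by simpa using ha))

theorem phiDeriv_line {s : ℝ} (hs : 5 / 2 < s) (v w : sobolevZero s) (t : ℝ) (x : UnitAddCircle) :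
    phiDeriv (v + t • w) x = phiDeriv v x + t * circleDeriv (w : Sobolev s) x := by
  have h : 3 / 2 < s := by linarith
  have h1 : ((v + t • w : sobolevZero s) : Sobolev s) = (v : Sobolev s) + t • (w : Sobolev s) := rfl
  rw [phiDeriv, phiDeriv, circleDeriv_eq h, circleDeriv_eq h, circleDeriv_eq h, h1, map_add,
    map_smul, Sobolev.add_apply, Sobolev.smul_apply]
  ring

theorem hasDerivAt_affine (a b : ℝ) : HasDerivAt (fun t : ℝ => a + t * b) b 0 := by
  simpa using ((hasDerivAt_id (0 : ℝ)).mul_const b).const_add a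

/-! ### The metrics -/

/-- The map `y ↦ (f₁ y₁ - f₂ y₂, f₁ y₂ - f₂ y₁)` is split-complex multiplication by the conjugate of
`f`, so it scales the Lorentz form by `f₁² - f₂² = ρ`. -/
theorem isometry_identity {f₁ f₂ y₁ y₂ z₁ z₂ ρ d d' u u' : ℝ} (hρ : ρ ≠ 0)
    (hf : f₁ ^ 2 - f₂ ^ 2 = ρ) (hd : d = 2 * (f₁ * y₁ - f₂ * y₂))
    (hd' : d' = 2 * (f₁ * z₁ - f₂ * z₂)) (hu : u * ρ = 2 * (f₁ * y₂ - f₂ * y₁))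
    (hu' : u' * ρ = 2 * (f₁ * z₂ - f₂ * z₁)) :
    y₁ * z₁ - y₂ * z₂ = 1 / 4 * (d * d' / ρ - u * u' * ρ) := by
  have h : u * u' * ρ = (u * ρ) * (u' * ρ) / ρ := by field_simp
  rw [h, hu, hu', hd, hd', ← sub_div, ← hf]
  rw [← hf] at hρ
  field_simp
  ring

/-- The derivative of a representative is found implicitly: along a line in `G`, both `f₁² - f₂² =
φₓ` and `log (f₁ + f₂) - log (f₁ - f₂) = α` are affine in `t`, and their slopes are the components
of the tangent vector. -/
theorem metricG_eq {s : ℝ} (hs : 5 / 2 < s) (a : G s) (g : TG s → Pair (s - 1))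
    (hg : IsLocalLift (id : U (s - 1) → U (s - 1)) (Phi hs) a g) (X X' : TG s) :
    metricU (s - 1) (g a) (fderiv ℝ g a X) (fderiv ℝ g a X') = metricG s a X X' := by
  obtain ⟨W, hW, haW, hsm, hlift⟩ := hg
  have heq : ∀ b : G s, (b : TG s) ∈ W → g b = phiMap hs b := fun b hb => by
    obtain ⟨h1, h2⟩ := hlift b hb
    exact congrArg Subtype.val h2
  have hfU : g a ∈ U (s - 1) := (hlift a haW).choose
  have hdiff : DifferentiableAt ℝ g a :=
    (hsm.contDiffAt (hW.mem_nhds haW)).differentiableAt (by simp)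
  have hopen : IsOpen (W ∩ G s) := hW.inter (isOpen_G (by linarith))
  have hphi : ∀ x, (g a).1 x ^ 2 - (g a).2 x ^ 2 = phiDeriv a.1.1 x := fun x => by
    rw [heq a haW, phiMap_sq_sub_sq hs a.2]
  have hline : ∀ {X : TG s}, g (a + (0 : ℝ) • X) = g a := by simp
  have hd : ∀ (X : TG s) x, circleDeriv (X.1 : Sobolev s) x
      = 2 * ((g a).1 x * (fderiv ℝ g a X).1 x - (g a).2 x * (fderiv ℝ g a X).2 x) := by
    intro X x
    have h1 := hasDerivAt_sq_sub_sq hs (hasDerivAt_line hdiff X) hline x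
    have h2 := hasDerivAt_affine (phiDeriv a.1.1 x) (circleDeriv (X.1 : Sobolev s) x)
    refine h2.unique (h1.congr_of_eventuallyEq ?_)
    filter_upwards [eventually_line_mem hopen ⟨haW, a.2⟩ X] with t ht
    rw [heq ⟨_, ht.2⟩ ht.1, phiMap_sq_sub_sq hs ht.2]
    exact (phiDeriv_line hs a.1.1 X.1 t x).symm
  have hα : ∀ (X : TG s) x, X.2 x * phiDeriv a.1.1 x
      = 2 * ((g a).1 x * (fderiv ℝ g a X).2 x - (g a).2 x * (fderiv ℝ g a X).1 x) := by
    intro X x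
    have h1 := hasDerivAt_log_sub_log hs (hasDerivAt_line hdiff X) hline hfU x
    have h2 := hasDerivAt_affine (a.1.2 x) (X.2 x)
    have h3 := h2.unique (h1.congr_of_eventuallyEq ?_)
    · rw [h3, hphi, div_mul_cancel₀ _ (a.2.2 x).ne']
    filter_upwards [eventually_line_mem hopen ⟨haW, a.2⟩ X] with t ht
    rw [heq ⟨_, ht.2⟩ ht.1, ← phiInv_snd_apply hs (phiMap_mem hs ht.2), phiInv_phiMap hs ht.2]
    rfl
  rw [metricU, pairing, metricG, ← integral_const_mul]
  refine integral_congr_ae (Eventually.of_forall fun x => ?_)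
  exact isometry_identity (a.2.2 x).ne' (hphi x) (hd X x) (hd X' x) (hα X x) (hα X' x)

theorem horizontal_fst {r : ℝ} (f Y : Pair r) (x : UnitAddCircle) :
    (horizontal r f Y).1 x = Y.1 x - pairing r Y (vertical r f) * f.2 x := by
  change Y.1.toC x + pairing r Y (vertical r f) * (-(f.2.toC x)) = _
  ring

theorem horizontal_snd {r : ℝ} (f Y : Pair r) (x : UnitAddCircle) :
    (horizontal r f Y).2 x = Y.2 x - pairing r Y (vertical r f) * f.1 x := by
  change Y.2.toC x + pairing r Y (vertical r f) * (-(f.1.toC x)) = _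
  ring

/-- If `U₂` is given by `A` up to a constant, where `A φₓ = 2 (f₁ Y₂ - f₂ Y₁)`, then `π(U₂)` is
given in the same way by the horizontal part of `Y`. -/
theorem piProj_mul_phiDeriv {s : ℝ} (hs : 5 / 2 < s) {v : sobolevZero s} {f Y : Pair (s - 1)}
    (hphi : ∀ x, f.1 x ^ 2 - f.2 x ^ 2 = phiDeriv v x) {U₂ : SobolevModConst (s - 1)} {c : ℝ}
    (hU : ∀ x, ((Quotient.out U₂ : Sobolev (s - 1)) x - c) * phiDeriv v x
      = 2 * (f.1 x * Y.2 x - f.2 x * Y.1 x)) (x : UnitAddCircle) :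
    piProj v U₂ x * phiDeriv v x = 2 * (f.1 x * (horizontal (s - 1) f Y).2 x
      - f.2 x * (horizontal (s - 1) f Y).1 x) := by
  have h : 3 / 2 < s := by linarith
  have hv₁ : ∀ y, (vertical (s - 1) f).1 y = -f.2 y := fun _ => rfl
  have hv₂ : ∀ y, (vertical (s - 1) f).2 y = -f.1 y := fun _ => rfl
  -- The integral of `f₁ Y₂ - f₂ Y₁` is the product of `Y` with the orbit direction, and the
  -- constant `c` survives because `∫ φₓ = 1`.
  have hint : ∫ y, (Quotient.out U₂ : Sobolev (s - 1)) y * phiDeriv v y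
      = 2 * pairing (s - 1) Y (vertical (s - 1) f) + c := by
    have e : ∀ y, (Quotient.out U₂ : Sobolev (s - 1)) y * phiDeriv v y
        = 2 * (Y.1 y * (vertical (s - 1) f).1 y - Y.2 y * (vertical (s - 1) f).2 y)
          + c * phiS h v y := fun y => by
      rw [hv₁, hv₂, phiS_apply]
      linear_combination hU y
    simp only [e]
    rw [integral_add ((pairing_integrable _ _ _).const_mul 2) ((integrable _).const_mul c),
      integral_const_mul, integral_const_mul, integral_phiS, mul_one]
    rfl
  rw [piProj, hint, horizontal_fst, horizontal_snd]
  linear_combination hU x + 2 * pairing (s - 1) Y (vertical (s - 1) f) * hphi x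

/-- A representative of `Ψ` is determined only up to a boost that may vary with the point. The boost
leaves `f₁² - f₂²` unchanged and shifts the logarithmic difference by a constant, so the argument
for `Φ` applies to that difference minus its value at 0. -/
theorem metricK_eq {s : ℝ} (hs : 5 / 2 < s) (a : K s) (g : TK s → Pair (s - 1))
    (hg : IsLocalLift (q (s - 1)) (Psi hs) a g) (X X' : TK s) :
    metricV (s - 1) (g a) (fderiv ℝ g a X) (fderiv ℝ g a X') = metricK s a X X' := by
  have hr : 1 / 2 < s - 1 := by linarith
  obtain ⟨W, hW, haW, hsm, hlift⟩ := hg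
  have hmem : ∀ b : K s, (b : TK s) ∈ W → g b ∈ U (s - 1) := fun b hb => (hlift b hb).choose
  have heq : ∀ (b : K s) (hb : (b : TK s) ∈ W), p s (PhiInv hs ⟨g b, hmem b hb⟩) = b :=
    fun b hb => by
      refine (bijective_Psi hs).injective ?_
      rw [Psi_p, Phi_PhiInv]
      exact (hlift b hb).choose_spec
  have hphi : ∀ (b : K s), (b : TK s) ∈ W → ∀ x,
      (g b).1 x ^ 2 - (g b).2 x ^ 2 = phiDeriv b.1.1 x := fun b hb x => by
    have h1 : (phiInv hs (g b)).1 = b.1.1 := congrArg (fun c : K s => c.1.1) (heq b hb)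
    rw [← h1, phiDeriv_phiInv hs (hmem b hb)]
  have hlog : ∀ (b : K s), (b : TK s) ∈ W → ∀ x, modConstSection hr b.1.2 x
      = (phiInv hs (g b)).2 x - (phiInv hs (g b)).2 0 := fun b hb x => by
    have h1 : Submodule.Quotient.mk (phiInv hs (g b)).2 = b.1.2 :=
      congrArg (fun c : K s => c.1.2) (heq b hb)
    rw [← h1, modConstSection_mk, Sobolev.sub_apply, Sobolev.smul_apply, one_apply, mul_one]
  have hfU : g a ∈ U (s - 1) := hmem a haW
  have hdiff : DifferentiableAt ℝ g a :=
    (hsm.contDiffAt (hW.mem_nhds haW)).differentiableAt (by simp)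
  have hopen : IsOpen (W ∩ K s) := hW.inter (isOpen_K (by linarith))
  have hline : ∀ {X : TK s}, g (a + (0 : ℝ) • X) = g a := by simp
  have hd : ∀ (X : TK s) x, circleDeriv (X.1 : Sobolev s) x
      = 2 * ((g a).1 x * (fderiv ℝ g a X).1 x - (g a).2 x * (fderiv ℝ g a X).2 x) := by
    intro X x
    have h1 := hasDerivAt_sq_sub_sq hs (hasDerivAt_line hdiff X) hline x
    have h2 := hasDerivAt_affine (phiDeriv a.1.1 x) (circleDeriv (X.1 : Sobolev s) x)
    refine h2.unique (h1.congr_of_eventuallyEq ?_)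
    filter_upwards [eventually_line_mem hopen ⟨haW, a.2⟩ X] with t ht
    rw [hphi ⟨_, ht.2⟩ ht.1]
    exact (phiDeriv_line hs a.1.1 X.1 t x).symm
  have hα : ∀ (X : TK s), ∃ c : ℝ, ∀ x,
      ((Quotient.out X.2 : Sobolev (s - 1)) x - c) * phiDeriv a.1.1 x
      = 2 * ((g a).1 x * (fderiv ℝ g a X).2 x - (g a).2 x * (fderiv ℝ g a X).1 x) := by
    intro X
    have h1 := hasDerivAt_log_sub_log hs (hasDerivAt_line hdiff X) hline hfU
    have key : ∀ x, modConstSection hr X.2 x = _ - _ := fun x => by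
      have h2 := hasDerivAt_affine (modConstSection hr a.1.2 x) (modConstSection hr X.2 x)
      refine h2.unique (((h1 x).sub (h1 0)).congr_of_eventuallyEq ?_)
      filter_upwards [eventually_line_mem hopen ⟨haW, a.2⟩ X] with t ht
      have h3 := hlog ⟨_, ht.2⟩ ht.1 x
      rw [phiInv_snd_apply hs (hmem ⟨_, ht.2⟩ ht.1), phiInv_snd_apply hs (hmem ⟨_, ht.2⟩ ht.1)]
        at h3
      refine Eq.trans ?_ h3
      change _ = (modConstSection hr (a.1.2 + t • X.2)) x
      rw [map_add, map_smul, Sobolev.add_apply, Sobolev.smul_apply]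
    -- This constant collects the two normalisations at 0: that of the chosen representative of the
    -- class and that of the logarithmic derivative.
    refine ⟨(Quotient.out X.2 : Sobolev (s - 1)) 0 - 2 * ((g a).1 0 * (fderiv ℝ g a X).2 0
      - (g a).2 0 * (fderiv ℝ g a X).1 0) / ((g a).1 0 ^ 2 - (g a).2 0 ^ 2), fun x => ?_⟩
    have h4 := (a.2.2 x).ne'
    rw [out_apply hr X.2 x, key x, hphi a haW x]
    field_simp
    ring
  obtain ⟨c, hc⟩ := hα X
  obtain ⟨c', hc'⟩ := hα X'
  rw [metricV, pairing, metricK, ← integral_const_mul]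
  refine integral_congr_ae (Eventually.of_forall fun x => ?_)
  refine isometry_identity (a.2.2 x).ne' (hphi a haW x) ?_ ?_
    (piProj_mul_phiDeriv hs (hphi a haW) hc x) (piProj_mul_phiDeriv hs (hphi a haW) hc' x)
  -- The vertical correction cancels in `f₁ Y₁ - f₂ Y₂`, since moving along the orbit does not
  -- change `φ`.
  · rw [hd, horizontal_fst, horizontal_snd]
    ring
  · rw [hd, horizontal_fst, horizontal_snd]
    ring

end HunterSaxton

end

theorem theorem3p10 (s : ℝ) (hs : 5 / 2 < s) :
    ∃ (Φ : HunterSaxton.G s → HunterSaxton.U (s - 1))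
      (Ψ : HunterSaxton.K s → HunterSaxton.V (s - 1)),
      -- `Φ(φ, α) = √φₓ (cosh(α/2), sinh(α/2))`
      (∀ (g : HunterSaxton.G s) (x : UnitAddCircle),
        (Φ g).1.1 x = √(HunterSaxton.phiDeriv g.1.1 x) * Real.cosh (g.1.2 x / 2) ∧
        (Φ g).1.2 x = √(HunterSaxton.phiDeriv g.1.1 x) * Real.sinh (g.1.2 x / 2)) ∧
      -- `Ψ(φ, [α]) = [Φ(φ, α)]`, that is, the diagram commutes
      (∀ g : HunterSaxton.G s,
        Ψ (HunterSaxton.p s g) = HunterSaxton.q (s - 1) (Φ g)) ∧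
      HunterSaxton.IsBijectiveIsometry (HunterSaxton.metricG s) (HunterSaxton.metricU (s - 1))
        (id : HunterSaxton.U (s - 1) → HunterSaxton.U (s - 1)) Φ ∧
      HunterSaxton.IsBijectiveIsometry (HunterSaxton.metricK s) (HunterSaxton.metricV (s - 1))
        (HunterSaxton.q (s - 1)) Ψ ∧
      -- equivariance of the two actions of `ℝ`
      (∀ (β : ℝ) (g : HunterSaxton.G s), Φ (β +ᵥ g) = β +ᵥ Φ g) := by
  open HunterSaxton in
  exact ⟨Phi hs, Psi hs, fun g x => ⟨phiMap_fst hs g.2 x, phiMap_snd hs g.2 x⟩, Psi_p hs,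
    { isOpen_domain := isOpen_G (by linarith)
      bijective := ⟨(PhiInv_Phi hs).injective, (Phi_PhiInv hs).surjective⟩
      smooth := isSmoothMap_Phi hs
      smooth_inverse := ⟨PhiInv hs, PhiInv_Phi hs, Phi_PhiInv hs, isSmoothMap_PhiInv hs⟩
      metric_eq := metricG_eq hs },
    { isOpen_domain := isOpen_K (by linarith)
      bijective := bijective_Psi hs
      smooth := isSmoothMap_Psi hs
      smooth_inverse := by
        let e := Equiv.ofBijective (Psi hs) (bijective_Psi hs)
        refine ⟨e.symm, e.left_inv, e.right_inv, ?_⟩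
        have h : e.symm ∘ q (s - 1) = p s ∘ PhiInv hs := funext fun f => by
          refine e.symm_apply_eq.mpr ?_
          change q (s - 1) f = Psi hs (p s (PhiInv hs f))
          rw [Psi_p, Phi_PhiInv hs f]
        rw [h]
        exact isSmoothMap_p_PhiInv hs
      metric_eq := metricK_eq hs },
    Phi_vadd hs⟩
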